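/- Let $\mathbb F$ be a finite field and let $d,q\ge 0$ be integers. Let $A(X)=\sum_{i=0}^d a_iX^i$ be a random polynomial of degree at most $d$, with coefficients $a_0,\dots,a_d$ independent and uniform in $\mathbb F$. A $q$-query quantum algorithm has access to $A$ on $\mathbb F\setminus\{0\}$ only, through phase queries, i.e. the unitary $|x,\xi,z\rangle\mapsto \xi(A(x))\,|x,\xi,z\rangle$, where $x\in\mathbb F\setminus\{0\}$, $\xi$ is a character of $(\mathbb F,+)$, and $z$ is a workspace register of arbitrary finite dimension. It starts in a fixed state, makes $q$ sequential queries, each followed by a unitary independent of $A$, and finally measures to output an element of $\mathbb F$. It succeeds if the output equals $A(0)$; its success probability is taken over the choice of $A$ and the measurement. Then, for each $d$ and $q$, the maximum $P$ of the success probabilities of all $q$-query quantum algorithms exists, and it satisfies the following. 1. If $q\le d/2$, then $P=\dfrac1{|\mathbb F|}$. 2. If $q=(d+1)/2$ and $q\le|\mathbb F|-1$, then $P\le\dfrac{\lfloor(|\mathbb F|-1)/q\rfloor}{|\mathbb F|}$, with equality whenever $q$ divides $|\mathbb F|-1$. 3. If $q\ge(d+2)/2$, then $P\ge 1-\dfrac{(\lfloor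 d/2\rfloor+1)!+d+1}{|\mathbb F|}$. -/

import Mathlib

open scoped Nat

noncomputable section

/-- The computational basis of the state space of a quantum algorithm that queries an oracle
`X → G` in the phase model: a query input `x`, a character `ξ` of `G`, and a workspace of
arbitrary finite dimension `k`. -/
abbrev QBasis (X G : Type*) [AddCommGroup G] (k : ℕ) : Type _ :=
  X × AddChar G ℂ × Fin k

/-- The state space: the Hilbert space with orthonormal basis `|x, ξ, z⟩`. -/
abbrev QState (X G : Type*) [AddCommGroup G] (k : ℕ) : Type _ :=
  EuclideanSpace ℂ (QBasis X G k)

/-- The phase query to `A`: `|x, ξ, z⟩ ↦ ξ(A x) |x, ξ, z⟩`, extended linearly. -/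
def phaseQuery {X G : Type*} [AddCommGroup G] {k : ℕ} (A : X → G) (ψ : QState X G k) :
    QState X G k :=
  WithLp.toLp 2 fun b => b.2.1 (A b.1) * ψ b

/-- A quantum oracle algorithm with outputs in `O`: a unit initial state, the
(oracle-independent) unitary applied after the `i`-th query, for each `i`, and a classical
decoding of the outcome of a measurement in the computational basis. As the workspace is
arbitrary, this covers mixed initial states, intermediate measurements and general final
measurements. -/
structure QAlgorithm (X G O : Type*) [Fintype X] [AddCommGroup G] [Finite G] where
  /-- the dimension of the workspace -/
  workDim : ℕ
  /-- the initial state -/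
  init : QState X G workDim
  norm_init : ‖init‖ = 1
  /-- the unitary applied after each query -/
  step : ℕ → (QState X G workDim ≃ₗᵢ[ℂ] QState X G workDim)
  /-- the output announced for each measurement outcome -/
  decode : QBasis X G workDim → O

namespace QAlgorithm

variable {X G O : Type*} [Fintype X] [AddCommGroup G] [Finite G]

/-- The state after `q` (sequential) queries to the oracle `A`. -/
def run (Q : QAlgorithm X G O) (A : X → G) : ℕ → QState X G Q.workDim
  | 0 => Q.init
  | i + 1 => Q.step i (phaseQuery A (Q.run A i))

/-- The probability that the algorithm outputs `o` after `q` queries to the oracle `A`. -/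
def outputProb [DecidableEq O] (Q : QAlgorithm X G O) (q : ℕ) (A : X → G) (o : O) : ℝ :=
  ∑ b : QBasis X G Q.workDim, if Q.decode b = o then ‖Q.run A q b‖ ^ 2 else 0

end QAlgorithm

/-- The polynomial `∑ i, a i * X ^ i` of degree at most `d`. -/
def polyOfCoeffs {F : Type*} [Field F] {d : ℕ} (a : Fin (d + 1) → F) : Polynomial F :=
  ∑ i : Fin (d + 1), Polynomial.monomial (i : ℕ) (a i)

/-- The probability that `Q`, making `q` queries to a uniformly random polynomial `A` of degree
at most `d` on the nonzero elements of the finite field `F`, outputs `A(0)`. -/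
def extrapolationProb {F : Type*} [Field F] [Fintype F] [DecidableEq F]
    (d q : ℕ) (Q : QAlgorithm {x : F // x ≠ 0} F F) : ℝ :=
  (∑ a : Fin (d + 1) → F,
      Q.outputProb q (fun x => (polyOfCoeffs a).eval (x : F)) ((polyOfCoeffs a).eval 0)) /
    (Fintype.card (Fin (d + 1) → F) : ℝ)

/-- `P` is the maximum success probability of a `q`-query quantum algorithm for extrapolating a
random polynomial of degree at most `d` over `F` to `0`. -/
def IsMaxExtrapolationProb (F : Type*) [Field F] [Fintype F] [DecidableEq F]
    (d q : ℕ) (P : ℝ) : Prop :=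
  IsGreatest (Set.range fun Q : QAlgorithm {x : F // x ≠ 0} F F => extrapolationProb d q Q) P

end

/-!
After `q` phase queries the state is a combination `∑ χ, χ A • Φ χ`, with vectors `Φ χ` independent
of the oracle `A`, over the characters `χ` of the group of oracles that are products of `q`
single-query characters. If the algorithm is to output `π A` for a homomorphism `π`, then
orthogonality of characters and the Cauchy–Schwarz inequality bound the success probability by
`N / |O|`, where `O` is the output group and `N` is the largest number of these characters in a
coset of the characters that factor through `π`. The bound is attained: query in superposition along
paths leading to the `N` characters of such a coset and apply the Fourier transform of `O`.

For polynomials the characters correspond to the moment vectors `∑ x, f x * x ^ j`, `0 ≤ j ≤ d`, of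
weight functions `f` on `F ∖ {0}` with at most `q` nonzero values, and `N` is the largest number of
values of the zeroth moment when the other moments are prescribed. A nonzero function supported on
at most `d` nonzero points has a nonzero moment of some order between `1` and `d`. So for
`2 * q ≤ d` the weight function is determined by its moments of positive order, and for
`2 * q = d + 1` distinct solutions have disjoint supports of size `q`; in the latter case the cosets
of the `q`-th roots of unity give solutions that fill `F ∖ {0}`. For large `q` a second moment
argument shows that some prescription of the other moments is compatible with almost all values of
the zeroth one.
-/

open Finset

open scoped Pointwise

lemma norm_sum_sq_le_ncard_support_mul {ι E : Type*} [Fintype ι] [NormedAddCommGroup E]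
    (g : ι → E) : ‖∑ i, g i‖ ^ 2 ≤ g.support.ncard * ∑ i, ‖g i‖ ^ 2 := by
  classical
  have hsupp : g.support.ncard = #{i | g i ≠ 0} := by
    rw [← Set.ncard_coe_finset]
    congr 1
    ext i
    simp
  calc ‖∑ i, g i‖ ^ 2 = ‖∑ i with g i ≠ 0, g i‖ ^ 2 := by rw [sum_filter_ne_zero]
    _ ≤ (∑ i with g i ≠ 0, ‖g i‖) ^ 2 := by
        gcongr
        exact norm_sum_le _ _
    _ ≤ #{i | g i ≠ 0} * ∑ i with g i ≠ 0, ‖g i‖ ^ 2 := sq_sum_le_card_mul_sum_sq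
    _ ≤ g.support.ncard * ∑ i, ‖g i‖ ^ 2 := by
        rw [hsupp]
        gcongr
        exact subset_univ _

section Characters

variable {V O : Type*} [AddCommGroup V] [AddCommGroup O] [Fintype O]

lemma orthonormal_addChar (V : Type*) [AddCommGroup V] [Fintype V] :
    Orthonormal ℂ fun χ : AddChar V ℂ =>
      (WithLp.toLp 2 fun a => χ a / (√(Fintype.card V) : ℂ) : EuclideanSpace ℂ V) := by
  classical
  have hcard : ((√(Fintype.card V) : ℝ) : ℂ) * (√(Fintype.card V) : ℝ) = Fintype.card V := by
    rw [← Complex.ofReal_mul, Real.mul_self_sqrt (Nat.cast_nonneg _), Complex.ofReal_natCast]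
  rw [orthonormal_iff_ite]
  intro χ ψ
  have hterm : ∀ a, inner ℂ (χ a / (√(Fintype.card V) : ℂ)) (ψ a / (√(Fintype.card V) : ℂ)) =
      (ψ / χ) a / Fintype.card V := fun a => by
    rw [RCLike.inner_apply, map_div₀, Complex.conj_ofReal, ← AddChar.map_neg_eq_conj,
      div_mul_div_comm, hcard, div_eq_mul_inv ψ χ, AddChar.mul_apply, AddChar.inv_apply]
  simp only [PiLp.inner_apply, hterm, ← sum_div, AddChar.sum_eq_ite, ← AddChar.one_eq_zero,
    div_eq_one, eq_comm (a := ψ)]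
  split_ifs
  · exact div_self (Nat.cast_ne_zero.2 Fintype.card_ne_zero)
  · exact zero_div _

lemma sum_norm_sq_sum_mul_addChar [Fintype V] (c : AddChar V ℂ → ℂ) :
    ∑ a, ‖∑ χ, c χ * χ a‖ ^ 2 = Fintype.card V * ∑ χ, ‖c χ‖ ^ 2 := by
  have hnorm := (orthonormal_addChar V).inner_sum c c univ
  have happly : ∀ a, (∑ χ, c χ • (WithLp.toLp 2 fun a => χ a / (√(Fintype.card V) : ℂ) :
      EuclideanSpace ℂ V)) a = (∑ χ, c χ * χ a) / (√(Fintype.card V) : ℂ) := fun a => by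
    simp [sum_div, mul_div_assoc]
  rw [inner_self_eq_norm_sq_to_K] at hnorm
  simp only [RCLike.conj_mul, ← RCLike.ofReal_pow, ← RCLike.ofReal_sum] at hnorm
  rw [← RCLike.ofReal_inj.1 hnorm, EuclideanSpace.norm_sq_eq]
  simp only [happly, norm_div, div_pow, ← sum_div, Complex.norm_real, Real.norm_eq_abs, sq_abs,
    Real.sq_sqrt (Nat.cast_nonneg _)]
  rw [mul_div_cancel₀ _ (Nat.cast_ne_zero.2 Fintype.card_ne_zero)]

lemma ite_sum_mul_addChar [Finite V] [DecidableEq O] (π : V →+ O) (c : AddChar V ℂ → ℂ) (o : O)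
    (a : V) :
    (if π a = o then ∑ χ, c χ * χ a else 0) =
      ∑ χ, (∑ η : AddChar O ℂ, η o * c (χ * η.compAddMonoidHom π)) / Fintype.card O * χ a := by
  have hshift : ∀ η : AddChar O ℂ, ∑ χ, c (χ * η.compAddMonoidHom π) * χ a =
      η (-π a) * ∑ χ, c χ * χ a := fun η => by
    rw [← Equiv.sum_comp (Equiv.mulRight (η.compAddMonoidHom π)) (fun χ => c χ * χ a), mul_sum]
    refine sum_congr rfl fun χ _ => ?_
    have hη : η (-π a) * η (π a) = 1 := by
      rw [← AddChar.map_add_eq_mul, neg_add_cancel, AddChar.map_zero_eq_one]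
    simp only [Equiv.coe_mulRight, AddChar.mul_apply, AddChar.compAddMonoidHom_apply]
    linear_combination (-c (χ * η.compAddMonoidHom π) * χ a) * hη
  calc (if π a = o then ∑ χ, c χ * χ a else 0)
      = (∑ η : AddChar O ℂ, η (o - π a)) / Fintype.card O * ∑ χ, c χ * χ a := by
        rw [AddChar.sum_apply_eq_ite]
        simp only [sub_eq_zero, eq_comm (a := o)]
        split_ifs
        · rw [div_self (Nat.cast_ne_zero.2 Fintype.card_ne_zero), one_mul]
        · rw [zero_div, zero_mul]
    _ = (∑ η : AddChar O ℂ, η o * ∑ χ, c (χ * η.compAddMonoidHom π) * χ a) / Fintype.card O := by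
        simp only [hshift, sub_eq_add_neg, AddChar.map_add_eq_mul, sum_mul, div_mul_eq_mul_div,
          mul_assoc]
    _ = _ := by
        simp only [mul_sum, sum_div, sum_mul]
        rw [sum_comm]
        refine sum_congr rfl fun χ _ => sum_congr rfl fun η _ => ?_
        ring

lemma sum_norm_sq_fiber_le [Fintype V] [DecidableEq O] (π : V →+ O) (c : AddChar V ℂ → ℂ) {M : ℕ}
    (hM : ∀ χ, {η : AddChar O ℂ | c (χ * η.compAddMonoidHom π) ≠ 0}.ncard ≤ M) (o : O) :
    ∑ a with π a = o, ‖∑ χ, c χ * χ a‖ ^ 2 ≤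
      Fintype.card V * (M / Fintype.card O * ∑ χ, ‖c χ‖ ^ 2) := by
  have hnorm : ∀ (η : AddChar O ℂ) (z : ℂ), ‖η o * z‖ = ‖z‖ := fun η z => by
    rw [norm_mul, AddChar.norm_apply, one_mul]
  have hcoeff : ∀ χ, ‖∑ η : AddChar O ℂ, η o * c (χ * η.compAddMonoidHom π)‖ ^ 2 ≤
      M * ∑ η : AddChar O ℂ, ‖c (χ * η.compAddMonoidHom π)‖ ^ 2 := fun χ => by
    refine (norm_sum_sq_le_ncard_support_mul _).trans ?_
    simp only [hnorm]
    gcongr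
    refine (Set.ncard_le_ncard fun η hη => ?_).trans (hM χ)
    exact right_ne_zero_of_mul hη
  have htranslate : ∀ η : AddChar O ℂ, ∑ χ, ‖c (χ * η.compAddMonoidHom π)‖ ^ 2 =
      ∑ χ, ‖c χ‖ ^ 2 := fun η =>
    Equiv.sum_comp (Equiv.mulRight (η.compAddMonoidHom π)) fun χ => ‖c χ‖ ^ 2
  have hO : (Fintype.card O : ℝ) ≠ 0 := Nat.cast_ne_zero.2 Fintype.card_ne_zero
  calc ∑ a with π a = o, ‖∑ χ, c χ * χ a‖ ^ 2
      = ∑ a, ‖if π a = o then ∑ χ, c χ * χ a else 0‖ ^ 2 := by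
        rw [sum_filter]
        exact sum_congr rfl fun a _ => by split_ifs <;> simp
    _ = Fintype.card V * ∑ χ, ‖(∑ η : AddChar O ℂ, η o * c (χ * η.compAddMonoidHom π)) /
          Fintype.card O‖ ^ 2 := by
        simp only [ite_sum_mul_addChar, sum_norm_sq_sum_mul_addChar]
    _ ≤ Fintype.card V * ∑ χ, M * (∑ η : AddChar O ℂ, ‖c (χ * η.compAddMonoidHom π)‖ ^ 2) /
          (Fintype.card O) ^ 2 := by
        gcongr with χ
        rw [norm_div, div_pow, Complex.norm_natCast]
        gcongr
        exact hcoeff χ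
    _ = Fintype.card V * (M / Fintype.card O * ∑ χ, ‖c χ‖ ^ 2) := by
        rw [← sum_div, ← mul_sum, sum_comm]
        simp only [htranslate, sum_const, card_univ, AddChar.card_eq, nsmul_eq_mul]
        field_simp

end Characters

section ReachableCharacters

variable {X G V O : Type*} [AddCommGroup G] [AddCommGroup V] [AddCommGroup O]

/-- The character `a ↦ ξ (ev a x)` of the group `V` of oracles by which a phase query to `ev a`
multiplies the basis states `|x, ξ, z⟩`; here `r = (x, ξ)`. -/
def queryChar (ev : V →+ (X → G)) (r : X × AddChar G ℂ) : AddChar V ℂ :=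
  r.2.compAddMonoidHom ((Pi.evalAddMonoidHom (fun _ => G) r.1).comp ev)

/-- The characters of the group of oracles that a computational path with `q` queries can pick up
as its phase. -/
def reachable (ev : V →+ (X → G)) (q : ℕ) : Set (AddChar V ℂ) :=
  Set.range (queryChar ev) ^ q

/-- The characters `η` of the output group for which `χ` translated by the pullback of `η` along
`π` is reachable with `q` queries. -/
def charFiber (ev : V →+ (X → G)) (π : V →+ O) (q : ℕ) (χ : AddChar V ℂ) : Set (AddChar O ℂ) :=
  {η | χ * η.compAddMonoidHom π ∈ reachable ev q}

/-- The largest number of reachable characters in a coset of the group of characters that factor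
through `π` (counted with the multiplicity of the pullback when `π` is not surjective). -/
noncomputable def maxCharFiber (ev : V →+ (X → G)) (π : V →+ O) (q : ℕ) : ℕ :=
  ⨆ χ, (charFiber ev π q χ).ncard

/-- The probability that `Q`, making `q` queries to the oracle `ev a` for a uniformly random `a`,
outputs `π a`. -/
noncomputable def successProb [Fintype X] [Finite G] [Fintype V] [DecidableEq O] (ev : V →+ (X → G))
    (π : V →+ O) (q : ℕ) (Q : QAlgorithm X G O) : ℝ :=
  (∑ a, Q.outputProb q (ev a) (π a)) / Fintype.card V

lemma ncard_charFiber_le_maxCharFiber [Finite V] (ev : V →+ (X → G)) (π : V →+ O) (q : ℕ)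
    (χ : AddChar V ℂ) : (charFiber ev π q χ).ncard ≤ maxCharFiber ev π q :=
  le_ciSup (f := fun χ => (charFiber ev π q χ).ncard) (Set.finite_range _).bddAbove χ

lemma exists_ncard_charFiber_eq_maxCharFiber [Finite V] (ev : V →+ (X → G)) (π : V →+ O)
    (q : ℕ) : ∃ χ, (charFiber ev π q χ).ncard = maxCharFiber ev π q :=
  exists_eq_ciSup_of_finite

end ReachableCharacters

namespace QAlgorithm

variable {X G V O : Type*} [Fintype X] [AddCommGroup G] [Finite G] [AddCommGroup V]

/-- The coefficient `Φ_χ` in the decomposition `∑ χ, χ a • Φ_χ` of the state after `q` queries to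
the oracle `ev a` (see `run_eq_sum_amplitude`). -/
noncomputable def amplitude (Q : QAlgorithm X G O) (ev : V →+ (X → G)) :
    ℕ → AddChar V ℂ → QState X G Q.workDim
  | 0 => Pi.single 1 Q.init
  | q + 1 => fun χ =>
      Q.step q (WithLp.toLp 2 fun b => Q.amplitude ev q (χ / queryChar ev (b.1, b.2.1)) b)

variable (Q : QAlgorithm X G O) (ev : V →+ (X → G))

lemma mem_reachable_of_amplitude_ne_zero {q : ℕ} {χ : AddChar V ℂ}
    (h : Q.amplitude ev q χ ≠ 0) : χ ∈ reachable ev q := by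
  induction q generalizing χ with
  | zero =>
    by_contra hχ
    exact h (Pi.single_eq_of_ne (by simpa [reachable] using hχ) _)
  | succ q ih =>
    obtain ⟨b, hb⟩ : ∃ b, Q.amplitude ev q (χ / queryChar ev (b.1, b.2.1)) b ≠ 0 := by
      by_contra! hzero
      exact h (by simp [amplitude, hzero, ← Pi.zero_def])
    rw [reachable, pow_succ, ← div_mul_cancel χ (queryChar ev (b.1, b.2.1))]
    exact Set.mul_mem_mul (ih fun hzero => hb (by simp [hzero])) (Set.mem_range_self _)

variable [Finite V]

lemma sum_norm_sq_amplitude (q : ℕ) : ∑ χ, ‖Q.amplitude ev q χ‖ ^ 2 = 1 := by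
  induction q with
  | zero =>
    rw [Fintype.sum_eq_single 1 fun χ hχ => by simp [amplitude, hχ]]
    simp [amplitude, Q.norm_init]
  | succ q ih =>
    simp only [EuclideanSpace.norm_sq_eq] at ih
    simp only [amplitude, LinearIsometryEquiv.norm_map, EuclideanSpace.norm_sq_eq]
    rw [← ih, sum_comm, sum_comm (s := univ (α := AddChar V ℂ))]
    exact sum_congr rfl fun b _ =>
      Equiv.sum_comp (Equiv.divRight _) fun χ => ‖Q.amplitude ev q χ b‖ ^ 2

lemma run_eq_sum_amplitude (q : ℕ) (a : V) :
    Q.run (ev a) q = ∑ χ : AddChar V ℂ, χ a • Q.amplitude ev q χ := by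
  induction q with
  | zero =>
    rw [Fintype.sum_eq_single 1 fun χ hχ => by simp [amplitude, hχ]]
    simp [amplitude, run]
  | succ q ih =>
    simp only [run, amplitude, ih, ← map_smul, ← map_sum]
    congr 1
    ext b
    set ρ := queryChar ev (b.1, b.2.1)
    calc ρ a * (∑ χ : AddChar V ℂ, χ a • Q.amplitude ev q χ) b
        = ∑ χ : AddChar V ℂ, (χ * ρ) a * Q.amplitude ev q (χ * ρ / ρ) b := by
          simp only [WithLp.ofLp_sum, Finset.sum_apply, PiLp.smul_apply, smul_eq_mul, mul_sum,
            AddChar.mul_apply, mul_div_cancel_right]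
          exact sum_congr rfl fun χ _ => by ring
      _ = ∑ χ : AddChar V ℂ, χ a * Q.amplitude ev q (χ / ρ) b :=
          Equiv.sum_comp (Equiv.mulRight ρ) fun χ => χ a * Q.amplitude ev q (χ / ρ) b
      _ = _ := by simp [ρ]

end QAlgorithm

lemma successProb_le {X G V O : Type*} [Fintype X] [AddCommGroup G] [Finite G] [AddCommGroup V]
    [Fintype V] [AddCommGroup O] [Fintype O] [DecidableEq O] (ev : V →+ (X → G)) (π : V →+ O)
    (q : ℕ) (Q : QAlgorithm X G O) :
    successProb ev π q Q ≤ maxCharFiber ev π q / Fintype.card O := by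
  have hfiber : ∀ b χ, {η : AddChar O ℂ |
      Q.amplitude ev q (χ * η.compAddMonoidHom π) b ≠ 0}.ncard ≤ maxCharFiber ev π q :=
    fun b χ => by
      refine (Set.ncard_le_ncard fun η (hη : _ ≠ 0) => ?_).trans
        (ncard_charFiber_le_maxCharFiber ev π q χ)
      exact Q.mem_reachable_of_amplitude_ne_zero ev fun h => hη (by simp [h])
  have hrun : ∀ a b, Q.run (ev a) q b = ∑ χ : AddChar V ℂ, Q.amplitude ev q χ b * χ a :=
    fun a b => by simp [Q.run_eq_sum_amplitude, mul_comm]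
  rw [successProb, div_le_iff₀ (Nat.cast_pos.2 Fintype.card_pos)]
  calc ∑ a, Q.outputProb q (ev a) (π a)
      = ∑ b, ∑ a with π a = Q.decode b, ‖∑ χ : AddChar V ℂ, Q.amplitude ev q χ b * χ a‖ ^ 2 := by
        simp only [QAlgorithm.outputProb, hrun, sum_filter, eq_comm (a := Q.decode _)]
        exact sum_comm
    _ ≤ ∑ b, Fintype.card V *
          (maxCharFiber ev π q / Fintype.card O * ∑ χ, ‖Q.amplitude ev q χ b‖ ^ 2) :=
        sum_le_sum fun b _ => sum_norm_sq_fiber_le π _ (hfiber b) _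
    _ = Fintype.card V *
          (maxCharFiber ev π q / Fintype.card O * ∑ χ, ‖Q.amplitude ev q χ‖ ^ 2) := by
        simp only [EuclideanSpace.norm_sq_eq]
        rw [← mul_sum, ← mul_sum, sum_comm]
    _ = maxCharFiber ev π q / Fintype.card O * Fintype.card V := by
        rw [Q.sum_norm_sq_amplitude, mul_one, mul_comm]

section OrthonormalFamilies

variable {𝕜 E ι κ : Type*} [RCLike 𝕜] [NormedAddCommGroup E] [InnerProductSpace 𝕜 E]

lemma exists_linearIsometryEquiv_apply_eq [FiniteDimensional 𝕜 E] {v w : ι → E}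
    (hv : Orthonormal 𝕜 v) (hw : Orthonormal 𝕜 w) : ∃ U : E ≃ₗᵢ[𝕜] E, ∀ i, U (v i) = w i := by
  set b := Module.Basis.span hv.linearIndependent
  have hb : ∀ i, (b i : E) = v i := fun i => by rw [Module.Basis.span_apply]
  have hconstr : b.constr 𝕜 w ∘ b = w := funext (b.constr_basis 𝕜 w)
  have hb_orthonormal : Orthonormal 𝕜 b :=
    (Submodule.span 𝕜 (Set.range v)).subtypeₗᵢ.orthonormal_comp_iff.1
      (by simpa [Function.comp_def, hb])
  let L := (b.constr 𝕜 w).isometryOfOrthonormal hb_orthonormal (by rwa [hconstr])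
  refine ⟨L.extend.toLinearIsometryEquiv rfl, fun i => ?_⟩
  rw [LinearIsometry.coe_toLinearIsometryEquiv, ← hb, LinearIsometry.extend_apply]
  exact congrFun hconstr i

lemma orthonormal_sum_smul [Fintype κ] {w : κ → E} (hw : Orthonormal 𝕜 w)
    {u : ι → EuclideanSpace 𝕜 κ} (hu : Orthonormal 𝕜 u) :
    Orthonormal 𝕜 fun i => ∑ j, u i j • w j := by
  classical
  rw [orthonormal_iff_ite] at hu ⊢
  intro i j
  rw [← hu i j, hw.inner_sum, PiLp.inner_apply]
  exact sum_congr rfl fun l _ => by rw [RCLike.inner_apply, mul_comm]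

lemma norm_sq_sum_smul [Fintype ι] {v : ι → E} (hv : Orthonormal 𝕜 v) (θ : ι → 𝕜) :
    ‖∑ i, θ i • v i‖ ^ 2 = ∑ i, ‖θ i‖ ^ 2 := by
  have h := hv.inner_sum θ θ univ
  rw [inner_self_eq_norm_sq_to_K] at h
  simp only [RCLike.conj_mul] at h
  exact_mod_cast h

end OrthonormalFamilies

section FrameAlgorithms

variable {X G O ι : Type*} [AddCommGroup G] {k : ℕ}

lemma phaseQuery_sum_smul (A : X → G) (s : Finset ι) (c : ι → ℂ) (ψ : ι → QState X G k) :
    phaseQuery A (∑ j ∈ s, c j • ψ j) = ∑ j ∈ s, c j • phaseQuery A (ψ j) := by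
  ext b
  simp [phaseQuery, mul_sum, mul_left_comm]

lemma phaseQuery_single [DecidableEq (QBasis X G k)] (A : X → G) (b : QBasis X G k) :
    phaseQuery A (EuclideanSpace.single b 1) = b.2.1 (A b.1) • EuclideanSpace.single b 1 := by
  ext b'
  by_cases h : b' = b <;> simp [phaseQuery, h]

namespace QAlgorithm

variable [Fintype X] [Finite G] [Fintype ι]

/-- The algorithm that superposes, with amplitudes `θ`, paths running through the given
orthonormal families: the `j`-th path is in the state `v i j` before the `(i + 1)`-st query. -/
noncomputable def ofFrames (v : ℕ → ι → QState X G k) (hv : ∀ i, Orthonormal ℂ (v i))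
    (θ : ι → ℂ) (hθ : ∑ j, ‖θ j‖ ^ 2 = 1) (decode : QBasis X G k → O) : QAlgorithm X G O where
  workDim := k
  init := ∑ j, θ j • v 0 j
  norm_init := by rw [← sq_eq_sq₀ (norm_nonneg _) zero_le_one, norm_sq_sum_smul (hv 0), hθ, one_pow]
  step i := (exists_linearIsometryEquiv_apply_eq (hv i) (hv (i + 1))).choose
  decode := decode

lemma ofFrames_run (v : ℕ → ι → QState X G k) (hv : ∀ i, Orthonormal ℂ (v i)) (θ : ι → ℂ)
    (hθ : ∑ j, ‖θ j‖ ^ 2 = 1) (decode : QBasis X G k → O) (A : X → G) (phase : ℕ → ι → ℂ) {q : ℕ}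
    (hphase : ∀ i < q, ∀ j, phaseQuery A (v i j) = phase i j • v i j) :
    (ofFrames v hv θ hθ decode).run A q = ∑ j, ((∏ i ∈ range q, phase i j) * θ j) • v q j := by
  induction q with
  | zero => simp [run, ofFrames]
  | succ q ih =>
    have hU := exists_linearIsometryEquiv_apply_eq (hv q) (hv (q + 1))
    calc hU.choose (phaseQuery A ((ofFrames v hv θ hθ decode).run A q))
        = hU.choose (phaseQuery A (∑ j, ((∏ i ∈ range q, phase i j) * θ j) • v q j)) :=
          congrArg (fun ψ : QState X G k => hU.choose (phaseQuery A ψ))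
            (ih fun i hi => hphase i (hi.trans q.lt_succ_self))
      _ = ∑ j, ((∏ i ∈ range (q + 1), phase i j) * θ j) • v (q + 1) j := by
          simp only [phaseQuery_sum_smul, hphase q q.lt_succ_self, map_sum, map_smul,
            hU.choose_spec, smul_smul, prod_range_succ, mul_right_comm]

end QAlgorithm

end FrameAlgorithms

section Optimality

variable {X G V O : Type*} [AddCommGroup G] [AddCommGroup V] [AddCommGroup O]

lemma exists_seq_prod_queryChar_eq [Nonempty X] {ev : V →+ (X → G)} {q : ℕ} {χ : AddChar V ℂ}
    (hχ : χ ∈ reachable ev q) :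
    ∃ r : ℕ → X × AddChar G ℂ, ∏ i ∈ range q, queryChar ev (r i) = χ := by
  obtain ⟨f, hf⟩ := Set.mem_pow.1 hχ
  choose r hr using fun i => (f i).2
  have hprod : ∏ i, queryChar ev (r i) = χ := by simpa only [hr, List.prod_ofFn] using hf
  refine ⟨fun i => if h : i < q then r ⟨i, h⟩ else Classical.arbitrary _, ?_⟩
  rw [← hprod, ← Fin.prod_univ_eq_prod_range]
  simp

lemma maxCharFiber_pos [Nonempty X] [Finite V] [Finite O] (ev : V →+ (X → G)) (π : V →+ O)
    (q : ℕ) : 0 < maxCharFiber ev π q := by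
  obtain ⟨χ, hχ⟩ : (reachable ev q).Nonempty := (Set.range_nonempty _).pow
  have hpullback : (1 : AddChar O ℂ).compAddMonoidHom π = 1 := rfl
  have hone : χ * (1 : AddChar O ℂ).compAddMonoidHom π ∈ reachable ev q := by
    rwa [hpullback, mul_one]
  exact ((Set.ncard_pos (Set.toFinite _)).2 ⟨1, hone⟩).trans_le
    (ncard_charFiber_le_maxCharFiber ev π q χ)

variable [Fintype O]

open Classical in
/-- The uniform superposition of the basis states `|x, 1, o⟩`, `o ∈ O`, with phases `η o`. -/
noncomputable def fourierState (x : X) (η : AddChar O ℂ) : QState X G (Fintype.card O) :=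
  ∑ o, (η o / (√(Fintype.card O) : ℂ)) • EuclideanSpace.single (x, 1, Fintype.equivFin O o) 1

lemma fourierState_apply (x : X) (η : AddChar O ℂ) (o : O) :
    (fourierState x η : QState X G (Fintype.card O)) (x, 1, Fintype.equivFin O o) =
      η o / (√(Fintype.card O) : ℂ) := by
  classical
  simp [fourierState, Pi.single_apply]

open Classical in
/-- The computational paths indexed by a set `S` of characters of the output group: the path `η`
prepares the queries `r η 0, r η 1, …` in turn, tagged by `η` in the workspace, and ends after `q`
queries in the Fourier state of `η`. -/
noncomputable def pathFrame (x : X) (q : ℕ) {S : Finset (AddChar O ℂ)}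
    (r : S → ℕ → X × AddChar G ℂ) (i : ℕ) (η : S) : QState X G (Fintype.card O) :=
  if i < q then
    EuclideanSpace.single ((r η i).1, (r η i).2, Fintype.equivFinOfCardEq AddChar.card_eq η.1) 1
  else fourierState x η.1

variable [Fintype X] [Finite G]

lemma orthonormal_pathFrame (x : X) (q : ℕ) {S : Finset (AddChar O ℂ)}
    (r : S → ℕ → X × AddChar G ℂ) (i : ℕ) : Orthonormal ℂ (pathFrame x q r i) := by
  classical
  unfold pathFrame
  split_ifs
  · refine (EuclideanSpace.orthonormal_single (𝕜 := ℂ)).comp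
      (fun η : S => ((r η i).1, (r η i).2, Fintype.equivFinOfCardEq AddChar.card_eq η.1))
      fun η η' h => Subtype.ext ?_
    simpa using congrArg (fun b => b.2.2) h
  · have hsingle : Orthonormal ℂ fun o =>
        (EuclideanSpace.single (x, 1, Fintype.equivFin O o) 1 : QState X G (Fintype.card O)) :=
      (EuclideanSpace.orthonormal_single (𝕜 := ℂ)).comp _ fun o o' h => by simpa using h
    exact (orthonormal_sum_smul hsingle (orthonormal_addChar O)).comp _ Subtype.val_injective

lemma sum_norm_sq_inv_sqrt_card {ι : Type*} {S : Finset ι} (hS : S.Nonempty) :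
    ∑ _j : S, ‖((√(#S))⁻¹ : ℂ)‖ ^ 2 = 1 := by
  have hcard : (#S : ℝ) ≠ 0 := Nat.cast_ne_zero.2 hS.card_ne_zero
  simp [Real.sq_sqrt, hcard]

/-- The algorithm that runs through all the paths `r η`, `η ∈ S`, in uniform superposition. The
sign in `decode` makes the Fourier states add up constructively at the right outcome when the
phase of the path `η` is proportional to `η o`. -/
noncomputable def pathAlgorithm (x : X) (q : ℕ) {S : Finset (AddChar O ℂ)} (hS : S.Nonempty)
    (r : S → ℕ → X × AddChar G ℂ) : QAlgorithm X G O :=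
  .ofFrames (pathFrame x q r) (orthonormal_pathFrame x q r) (fun _ => ((√(#S))⁻¹ : ℂ))
    (sum_norm_sq_inv_sqrt_card hS) fun b => -(Fintype.equivFin O).symm b.2.2

lemma pathAlgorithm_run (x : X) (q : ℕ) {S : Finset (AddChar O ℂ)} (hS : S.Nonempty)
    (r : S → ℕ → X × AddChar G ℂ) (A : X → G) :
    (pathAlgorithm x q hS r).run A q = ∑ η : S,
      ((∏ i ∈ range q, (r η i).2 (A (r η i).1)) * (√(#S) : ℂ)⁻¹) •
        (fourierState x η.1 : QState X G (Fintype.card O)) := by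
  refine (QAlgorithm.ofFrames_run _ _ _ (sum_norm_sq_inv_sqrt_card hS) _ A
    (fun i η => (r η i).2 (A (r η i).1)) fun i hi η => ?_).trans (sum_congr rfl fun η _ => ?_)
  · simp only [pathFrame, if_pos hi, phaseQuery_single]
  · simp only [pathFrame, lt_irrefl, if_false]
    rfl

lemma pathAlgorithm_run_apply (x : X) (q : ℕ) {S : Finset (AddChar O ℂ)} (hS : S.Nonempty)
    (r : S → ℕ → X × AddChar G ℂ) {A : X → G} {c : ℂ} {o : O}
    (hr : ∀ η : S, ∏ i ∈ range q, (r η i).2 (A (r η i).1) = c * η.1 o) :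
    (pathAlgorithm x q hS r).run A q (x, 1, Fintype.equivFin O (-o)) =
      c * (√(#S) / √(Fintype.card O) : ℝ) := by
  have hinterfere : ∀ η : S, c * η.1 o * (√(#S) : ℂ)⁻¹ * (η.1 (-o) / (√(Fintype.card O) : ℂ)) =
      c * (√(#S) : ℂ)⁻¹ / (√(Fintype.card O) : ℂ) := fun η => by
    have hη : η.1 o * η.1 (-o) = 1 := by
      rw [← AddChar.map_add_eq_mul, add_neg_cancel, AddChar.map_zero_eq_one]
    linear_combination c * (√(#S) : ℂ)⁻¹ / (√(Fintype.card O) : ℂ) * hη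
  have hsqrt : (#S : ℝ) * (√(#S))⁻¹ = √(#S) := by rw [← div_eq_mul_inv, Real.div_sqrt]
  calc (pathAlgorithm x q hS r).run A q (x, 1, Fintype.equivFin O (-o))
      = ∑ η : S, c * η.1 o * (√(#S) : ℂ)⁻¹ * (η.1 (-o) / (√(Fintype.card O) : ℂ)) := by
        refine (congrArg (fun ψ : QState X G (Fintype.card O) =>
          ψ (x, 1, Fintype.equivFin O (-o))) (pathAlgorithm_run x q hS r A)).trans ?_
        simp [hr, fourierState_apply]
    _ = c * ((#S * (√(#S))⁻¹ : ℝ) / √(Fintype.card O) : ℝ) := by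
        simp only [hinterfere, sum_const, card_univ, Fintype.card_coe, nsmul_eq_mul]
        push_cast
        ring
    _ = c * (√(#S) / √(Fintype.card O) : ℝ) := by rw [hsqrt]

variable [DecidableEq O]

lemma le_outputProb_pathAlgorithm (x : X) (q : ℕ) {S : Finset (AddChar O ℂ)} (hS : S.Nonempty)
    (r : S → ℕ → X × AddChar G ℂ) (A : X → G) {c : ℂ} (hc : ‖c‖ = 1) (o : O)
    (hr : ∀ η : S, ∏ i ∈ range q, (r η i).2 (A (r η i).1) = c * η.1 o) :
    (#S : ℝ) / Fintype.card O ≤ (pathAlgorithm x q hS r).outputProb q A o := by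
  let b : QBasis X G (pathAlgorithm x q hS r).workDim := (x, 1, Fintype.equivFin O (-o))
  have hdecode : (pathAlgorithm x q hS r).decode b = o := by
    simp [pathAlgorithm, QAlgorithm.ofFrames, b]
  calc (#S : ℝ) / Fintype.card O = ‖(pathAlgorithm x q hS r).run A q b‖ ^ 2 := by
        rw [pathAlgorithm_run_apply x q hS r hr, norm_mul, hc, one_mul, Complex.norm_real,
          Real.norm_eq_abs, sq_abs, div_pow, Real.sq_sqrt (Nat.cast_nonneg _),
          Real.sq_sqrt (Nat.cast_nonneg _)]
    _ = if (pathAlgorithm x q hS r).decode b = o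
          then ‖(pathAlgorithm x q hS r).run A q b‖ ^ 2 else 0 := (if_pos hdecode).symm
    _ ≤ (pathAlgorithm x q hS r).outputProb q A o :=
        single_le_sum (f := fun b => if (pathAlgorithm x q hS r).decode b = o
          then ‖(pathAlgorithm x q hS r).run A q b‖ ^ 2 else 0)
          (fun _ _ => by split_ifs <;> positivity) (mem_univ b)

variable [Fintype V]

lemma exists_le_successProb [Nonempty X] (ev : V →+ (X → G)) (π : V →+ O) (q : ℕ) :
    ∃ Q : QAlgorithm X G O,
      (maxCharFiber ev π q : ℝ) / Fintype.card O ≤ successProb ev π q Q := by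
  obtain ⟨χ, hχ⟩ := exists_ncard_charFiber_eq_maxCharFiber ev π q
  set S : Finset (AddChar O ℂ) := (Set.toFinite (charFiber ev π q χ)).toFinset
  have hS : #S = maxCharFiber ev π q := by rw [← hχ, Set.ncard_eq_toFinset_card]
  have hS_nonempty : S.Nonempty := card_pos.1 (hS ▸ maxCharFiber_pos ev π q)
  have hreach : ∀ η : S, χ * η.1.compAddMonoidHom π ∈ reachable ev q := fun η =>
    (Set.toFinite (charFiber ev π q χ)).mem_toFinset.1 η.2
  choose r hr using fun η => exists_seq_prod_queryChar_eq (hreach η)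
  refine ⟨pathAlgorithm (Classical.arbitrary X) q hS_nonempty r, ?_⟩
  rw [successProb, le_div_iff₀ (Nat.cast_pos.2 Fintype.card_pos), mul_comm, ← hS, ← nsmul_eq_mul]
  refine card_nsmul_le_sum univ _ _ fun a _ =>
    le_outputProb_pathAlgorithm _ q hS_nonempty r (ev a) (AddChar.norm_apply χ a) (π a) fun η => ?_
  simpa [queryChar] using DFunLike.congr_fun (hr η) a

theorem isGreatest_range_successProb [Nonempty X] (ev : V →+ (X → G)) (π : V →+ O) (q : ℕ) :
    IsGreatest (Set.range (successProb ev π q : QAlgorithm X G O → ℝ))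
      (maxCharFiber ev π q / Fintype.card O) := by
  obtain ⟨Q, hQ⟩ := exists_le_successProb ev π q
  refine ⟨⟨Q, (successProb_le ev π q Q).antisymm hQ⟩, ?_⟩
  rintro _ ⟨Q, rfl⟩
  exact successProb_le ev π q Q

end Optimality

section SparseWeights

variable {R : Type*} [CommSemiring R]

/-- The `j`-th moment `∑ x, f x * x ^ j` of a finitely supported weight function `f`. -/
noncomputable def moment (j : ℕ) : (R →₀ R) →ₗ[R] R :=
  Finsupp.linearCombination R fun x => x ^ j

/-- The vector of the first `n` moments. -/
noncomputable def momentVec (n : ℕ) : (R →₀ R) →ₗ[R] (Fin n → R) :=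
  LinearMap.pi fun j => moment (j : ℕ)

/-- The weight functions on `P` with at most `q` nonzero values. -/
def sparseWeights (P : Finset R) (q : ℕ) : Set (R →₀ R) :=
  {f | f.support ⊆ P ∧ #f.support ≤ q}

/-- The possible values of the zeroth moment of a `q`-sparse weight function on `P` whose moments
of orders `1, …, d` are given by `u`. -/
def momentFiber (P : Finset R) (q : ℕ) {d : ℕ} (u : Fin d → R) : Set R :=
  {y | Fin.cons y u ∈ momentVec (d + 1) '' sparseWeights P q}

/-- The largest size of a `momentFiber`. -/
noncomputable def maxMomentFiber (P : Finset R) (d q : ℕ) : ℕ :=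
  ⨆ u : Fin d → R, (momentFiber P q u).ncard

lemma moment_apply (j : ℕ) (f : R →₀ R) : moment j f = f.sum fun x c => c * x ^ j :=
  Finsupp.linearCombination_apply R f

lemma moment_single (j : ℕ) (x c : R) : moment j (Finsupp.single x c) = c * x ^ j :=
  Finsupp.linearCombination_single R c x

lemma momentVec_single (n : ℕ) (x c : R) :
    momentVec n (Finsupp.single x c) = fun j : Fin n => c * x ^ (j : ℕ) :=
  funext fun _ => moment_single _ x c

lemma mem_momentFiber {P : Finset R} {q d : ℕ} {u : Fin d → R} {y : R} :
    y ∈ momentFiber P q u ↔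
      ∃ f ∈ sparseWeights P q, moment 0 f = y ∧ ∀ j : Fin d, moment (j + 1) f = u j := by
  refine exists_congr fun f => and_congr_right fun _ => ?_
  rw [funext_iff, Fin.forall_fin_succ]
  rfl

lemma ncard_momentFiber_le_maxMomentFiber [Finite R] (P : Finset R) (q : ℕ) {d : ℕ}
    (u : Fin d → R) : (momentFiber P q u).ncard ≤ maxMomentFiber P d q :=
  le_ciSup (f := fun u : Fin d → R => (momentFiber P q u).ncard) (Set.finite_range _).bddAbove u

lemma sparseWeights_zero (P : Finset R) : sparseWeights P 0 = {0} := by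
  ext f
  simp +contextual [sparseWeights]

lemma sparseWeights_succ {P : Finset R} (hP : P.Nonempty) (q : ℕ) :
    sparseWeights P (q + 1) =
      sparseWeights P q + {f | ∃ x ∈ P, ∃ c, Finsupp.single x c = f} := by
  classical
  ext f
  rw [Set.mem_add]
  constructor
  · rintro ⟨hfP, hfq⟩
    obtain rfl | ⟨x, hx⟩ := f.support.eq_empty_or_nonempty.imp_left Finsupp.support_eq_empty.1
    · obtain ⟨x, hx⟩ := hP
      exact ⟨0, by simp [sparseWeights], 0, ⟨x, hx, 0, by simp⟩, add_zero 0⟩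
    · refine ⟨f.erase x, ⟨?_, ?_⟩, _, ⟨x, hfP hx, f x, rfl⟩, f.erase_add_single x⟩
      · exact (f.support_erase ▸ erase_subset x _).trans hfP
      · rw [Finsupp.support_erase, card_erase_of_mem hx]
        exact Nat.sub_le_of_le_add hfq
  · rintro ⟨g, ⟨hgP, hgq⟩, _, ⟨x, hx, c, rfl⟩, rfl⟩
    have hsupp : (g + Finsupp.single x c).support ⊆ g.support ∪ {x} :=
      Finsupp.support_add.trans (union_subset_union_right Finsupp.support_single_subset)
    refine ⟨hsupp.trans (union_subset hgP (singleton_subset_iff.2 hx)), ?_⟩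
    exact (card_le_card hsupp).trans ((card_union_le _ _).trans (by simpa using hgq))

end SparseWeights

section DotChar

variable {R ι : Type*} [NonUnitalNonAssocRing R] [Fintype ι]

/-- The character `a ↦ e (w ⬝ᵥ a)` of the group of vectors. -/
def dotChar (e : AddChar R ℂ) (w : ι → R) : AddChar (ι → R) ℂ :=
  e.compAddMonoidHom (AddMonoidHom.mk' (w ⬝ᵥ ·) (dotProduct_add w))

lemma dotChar_apply (e : AddChar R ℂ) (w a : ι → R) : dotChar e w a = e (w ⬝ᵥ a) := rfl

lemma dotChar_add (e : AddChar R ℂ) (w w' : ι → R) :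
    dotChar e (w + w') = dotChar e w * dotChar e w' := by
  ext a
  simp [dotChar_apply, add_dotProduct, AddChar.map_add_eq_mul]

end DotChar

section PolynomialOracles

variable {F : Type*} [Field F]

lemma eval_polyOfCoeffs {d : ℕ} (a : Fin (d + 1) → F) (x : F) :
    (polyOfCoeffs a).eval x = (fun i : Fin (d + 1) => x ^ (i : ℕ)) ⬝ᵥ a := by
  simp [polyOfCoeffs, Polynomial.eval_finsetSum, dotProduct, mul_comm]

lemma eval_zero_polyOfCoeffs {d : ℕ} (a : Fin (d + 1) → F) : (polyOfCoeffs a).eval 0 = a 0 := by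
  simp [eval_polyOfCoeffs, dotProduct, Fin.sum_univ_succ]

/-- The oracle that evaluates a polynomial of degree at most `d` at the nonzero points of `F`. -/
noncomputable def evalNonzero (F : Type*) [Field F] (d : ℕ) :
    (Fin (d + 1) → F) →+ ({x : F // x ≠ 0} → F) :=
  AddMonoidHom.mk' (fun a x => (polyOfCoeffs a).eval (x : F)) fun a b => by
    ext x
    simp [eval_polyOfCoeffs, dotProduct_add]

lemma evalNonzero_apply {d : ℕ} (a : Fin (d + 1) → F) (x : {x : F // x ≠ 0}) :
    evalNonzero F d a x = (fun i : Fin (d + 1) => (x : F) ^ (i : ℕ)) ⬝ᵥ a :=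
  eval_polyOfCoeffs a x

lemma extrapolationProb_eq_successProb [Fintype F] [DecidableEq F] (d q : ℕ) :
    (extrapolationProb d q : QAlgorithm {x : F // x ≠ 0} F F → ℝ) =
      successProb (evalNonzero F d) (Pi.evalAddMonoidHom (fun _ => F) 0) q := by
  ext Q
  simp only [extrapolationProb, eval_zero_polyOfCoeffs]
  rfl

variable {e : AddChar F ℂ}

lemma dotChar_momentVec_single (d : ℕ) (x : {x : F // x ≠ 0}) (c : F) :
    dotChar e (momentVec (d + 1) (Finsupp.single (x : F) c)) =
      queryChar (evalNonzero F d) (x, e.mulShift c) := by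
  ext a
  change e _ = e (c * evalNonzero F d a x)
  simp only [evalNonzero_apply, momentVec_single, dotProduct, mul_sum, mul_assoc]
  rfl

lemma exists_isPrimitive_addChar (F : Type*) [Field F] [Finite F] :
    ∃ e : AddChar F ℂ, e.IsPrimitive := by
  obtain ⟨e, he⟩ := (AddChar.exists_apply_ne_zero (a := (1 : F))).2 one_ne_zero
  exact ⟨e, AddChar.IsPrimitive.of_ne_one (AddChar.ne_one_iff.2 ⟨1, he⟩)⟩

lemma bijective_mulShift [Finite F] (he : e.IsPrimitive) : Function.Bijective e.mulShift := by
  have := Fintype.ofFinite F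
  exact (Fintype.bijective_iff_injective_and_card _).2
    ⟨AddChar.to_mulShift_inj_of_isPrimitive he, AddChar.card_eq.symm⟩

lemma bijective_dotChar {ι : Type*} [Fintype ι] [Finite F] (he : e.IsPrimitive) :
    Function.Bijective (dotChar e : (ι → F) → AddChar (ι → F) ℂ) := by
  classical
  have := Fintype.ofFinite F
  refine (Fintype.bijective_iff_injective_and_card _).2 ⟨fun w w' h => funext fun i => ?_,
    AddChar.card_eq.symm⟩
  refine (bijective_mulShift he).1 (DFunLike.ext _ _ fun x => ?_)
  simpa [dotChar_apply] using DFunLike.congr_fun h (Pi.single i x)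

variable [Fintype F] [DecidableEq F]

lemma reachable_evalNonzero (he : e.IsPrimitive) (d q : ℕ) :
    reachable (evalNonzero F d) q =
      (fun f => dotChar e (momentVec (d + 1) f)) '' sparseWeights (univ.erase 0) q := by
  have hadd : ∀ f g, dotChar e (momentVec (d + 1) (f + g)) =
      dotChar e (momentVec (d + 1) f) * dotChar e (momentVec (d + 1) g) := fun f g => by
    rw [map_add, dotChar_add]
  have hquery : Set.range (queryChar (evalNonzero F d)) =
      (fun f => dotChar e (momentVec (d + 1) f)) ''
        {f | ∃ x ∈ univ.erase (0 : F), ∃ c, Finsupp.single x c = f} := by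
    ext χ
    constructor
    · rintro ⟨⟨x, ξ⟩, rfl⟩
      obtain ⟨c, rfl⟩ := (bijective_mulShift he).2 ξ
      exact ⟨_, ⟨x, by simpa using x.2, c, rfl⟩, dotChar_momentVec_single d x c⟩
    · rintro ⟨_, ⟨x, hx, c, rfl⟩, rfl⟩
      exact ⟨(⟨x, ne_of_mem_erase hx⟩, e.mulShift c), (dotChar_momentVec_single d ⟨x, _⟩ c).symm⟩
  induction q with
  | zero =>
    ext χ
    simp [reachable, sparseWeights_zero, DFunLike.ext_iff, dotChar_apply, eq_comm]
  | succ q ih =>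
    have hP : (univ.erase (0 : F)).Nonempty := ⟨1, by simp⟩
    rw [reachable, pow_succ, ← reachable, ih, hquery, sparseWeights_succ hP]
    exact (Set.image_image2_distrib (g := fun f => dotChar e (momentVec (d + 1) f)) hadd).symm

lemma charFiber_dotChar (he : e.IsPrimitive) {d : ℕ} (q : ℕ) (w : Fin (d + 1) → F) :
    charFiber (evalNonzero F d) (Pi.evalAddMonoidHom (fun _ => F) 0) q (dotChar e w) =
      (fun y => e.mulShift (y - w 0)) '' momentFiber (univ.erase 0) q (Fin.tail w) := by
  have htranslate : ∀ y, dotChar e w *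
      (e.mulShift (y - w 0)).compAddMonoidHom (Pi.evalAddMonoidHom (fun _ => F) 0) =
        dotChar e (Fin.cons y (Fin.tail w) : Fin (d + 1) → F) := fun y => by
    ext a
    change dotChar e w a * e ((y - w 0) * a 0) = _
    rw [dotChar_apply, dotChar_apply, ← AddChar.map_add_eq_mul]
    simp only [dotProduct, Fin.sum_univ_succ, Fin.cons_zero, Fin.cons_succ, Fin.tail]
    congr 1
    ring
  have hsurj : Function.Surjective fun y => e.mulShift (y - w 0) :=
    (bijective_mulShift he).2.comp (Equiv.subRight (w 0)).surjective
  ext η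
  obtain ⟨y, rfl⟩ := hsurj η
  have hinj : Function.Injective fun y => e.mulShift (y - w 0) :=
    (bijective_mulShift he).1.comp ((Equiv.subRight (w 0)).injective)
  rw [hinj.mem_set_image]
  change _ * _ ∈ reachable _ q ↔ _
  rw [htranslate, reachable_evalNonzero he, ← Set.image_image (dotChar e),
    (bijective_dotChar he).1.mem_set_image]
  rfl

theorem maxCharFiber_evalNonzero (d q : ℕ) :
    maxCharFiber (evalNonzero F d) (Pi.evalAddMonoidHom (fun _ => F) 0) q =
      maxMomentFiber (univ.erase (0 : F)) d q := by
  obtain ⟨e, he⟩ := exists_isPrimitive_addChar F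
  have hsurj : Function.Surjective (Fin.tail : (Fin (d + 1) → F) → Fin d → F) :=
    fun u => ⟨Fin.cons 0 u, Fin.tail_cons (α := fun _ => F) 0 u⟩
  rw [maxCharFiber, maxMomentFiber, ← (bijective_dotChar he).2.iSup_comp, ← hsurj.iSup_comp]
  refine iSup_congr fun w => ?_
  rw [charFiber_dotChar he, Set.ncard_image_of_injective]
  exact (bijective_mulShift he).1.comp ((Equiv.subRight (w 0)).injective)

theorem isMaxExtrapolationProb_maxMomentFiber (d q : ℕ) :
    IsMaxExtrapolationProb F d q
      (maxMomentFiber (univ.erase (0 : F)) d q / Fintype.card F) := by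
  have : Nonempty {x : F // x ≠ 0} := ⟨⟨1, one_ne_zero⟩⟩
  rw [IsMaxExtrapolationProb, ← maxCharFiber_evalNonzero]
  simpa only [extrapolationProb_eq_successProb] using
    isGreatest_range_successProb (evalNonzero F d) (Pi.evalAddMonoidHom (fun _ => F) 0) q

end PolynomialOracles

section MomentUniqueness

lemma card_support_sub_add_le {ι G : Type*} [DecidableEq ι] [AddGroup G] (f g : ι →₀ G) :
    #(f - g).support + #(f.support ∩ g.support) ≤ #f.support + #g.support :=
  (Nat.add_le_add_right (card_le_card Finsupp.support_sub) _).trans_eq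
    (card_union_add_card_inter _ _)

variable {R : Type*} [CommRing R] [IsDomain R]

theorem lt_card_support_of_moment_eq_zero {f : R →₀ R} (hf : f ≠ 0) {n : ℕ} (s : ℕ)
    (hs : ∀ x ∈ f.support, x ^ s ≠ 0) (h : ∀ j < n, moment (s + j) f = 0) : n < #f.support := by
  by_contra! hn
  let x : Fin #f.support → R := fun i => f.support.equivFin.symm i
  have hvandermonde : (fun i => f (x i) * x i ^ s) = 0 := by
    refine Matrix.eq_zero_of_forall_pow_sum_mul_pow_eq_zero (f := x)
      (Subtype.val_injective.comp f.support.equivFin.symm.injective) fun j => ?_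
    rw [← h j (j.2.trans_le hn), moment_apply, Finsupp.sum, ← sum_coe_sort f.support,
      ← f.support.equivFin.symm.sum_comp]
    simp only [pow_add, mul_assoc, x]
  obtain ⟨y, hy⟩ := Finsupp.support_nonempty_iff.2 hf
  have hvanish := congrFun hvandermonde (f.support.equivFin ⟨y, hy⟩)
  simp [x, Finsupp.mem_support_iff.1 hy, hs y hy] at hvanish

lemma lt_card_support_sub {P : Finset R} (h0 : 0 ∉ P) {d : ℕ} {f g : R →₀ R} (hfg : f ≠ g)
    (hf : f.support ⊆ P) (hg : g.support ⊆ P)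
    (h : ∀ j : Fin d, moment (j + 1) f = moment (j + 1) g) : d < #(f - g).support := by
  classical
  refine lt_card_support_of_moment_eq_zero (sub_ne_zero.2 hfg) 1 (fun x hx => ?_) fun j hj => ?_
  · rw [pow_one]
    rintro rfl
    exact h0 (union_subset hf hg (Finsupp.support_sub hx))
  · rw [map_sub, add_comm, h ⟨j, hj⟩, sub_self]

variable [Finite R]

theorem maxMomentFiber_eq_one {P : Finset R} (h0 : 0 ∉ P) {d q : ℕ} (h : 2 * q ≤ d) :
    maxMomentFiber P d q = 1 := by
  classical
  refine le_antisymm (ciSup_le fun u => (Set.ncard_le_one).2 fun y hy z hz => ?_) ?_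
  · obtain ⟨f, ⟨hfP, hfq⟩, rfl, hf⟩ := mem_momentFiber.1 hy
    obtain ⟨g, ⟨hgP, hgq⟩, rfl, hg⟩ := mem_momentFiber.1 hz
    by_contra hne
    have := lt_card_support_sub h0 (ne_of_apply_ne _ hne) hfP hgP fun j => (hf j).trans (hg j).symm
    have := card_support_sub_add_le f g
    omega
  · have hmem : (0 : R) ∈ momentFiber P q (0 : Fin d → R) :=
      mem_momentFiber.2 ⟨0, by simp [sparseWeights], by simp⟩
    exact ((Set.ncard_pos).2 ⟨0, hmem⟩).trans_le (ncard_momentFiber_le_maxMomentFiber P q _)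

lemma mul_ncard_momentFiber_le {P : Finset R} (h0 : 0 ∉ P) {d q : ℕ} (h : 2 * q ≤ d + 1)
    (hq : q ≤ #P) (u : Fin d → R) : q * (momentFiber P q u).ncard ≤ #P := by
  classical
  rw [← Nat.card_coe_set_eq]
  have : Fintype (momentFiber P q u) := Fintype.ofFinite _
  rw [Nat.card_eq_fintype_card]
  choose f hf hf0 hfu using fun y : momentFiber P q u => mem_momentFiber.1 y.2
  have hsep : ∀ y z, y ≠ z → #(f y).support = q ∧ Disjoint (f y).support (f z).support := by
    intro y z hyz
    have hne : f y ≠ f z := fun h => hyz (Subtype.ext ((hf0 y).symm.trans (h ▸ hf0 z)))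
    have hlt := lt_card_support_sub h0 hne (hf y).1 (hf z).1 fun j => (hfu y j).trans (hfu z j).symm
    have hle := card_support_sub_add_le (f y) (f z)
    have hy := (hf y).2
    have hz := (hf z).2
    rw [disjoint_iff_inter_eq_empty, ← card_eq_zero]
    omega
  obtain hsub | hnontriv := subsingleton_or_nontrivial (momentFiber P q u)
  · exact (mul_le_of_le_one_right q.zero_le (Fintype.card_le_one_iff_subsingleton.2 hsub)).trans hq
  · have hcard : ∀ y, #(f y).support = q := fun y =>
      have ⟨z, hz⟩ := exists_ne y
      (hsep y z hz.symm).1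
    calc q * Fintype.card (momentFiber P q u)
        = ∑ y, #(f y).support := by simp [hcard, mul_comm]
      _ = #(univ.biUnion fun y => (f y).support) :=
          (card_biUnion fun y _ z _ hyz => (hsep y z hyz).2).symm
      _ ≤ #P := card_le_card (biUnion_subset.2 fun y _ => (hf y).1)

theorem mul_maxMomentFiber_le {P : Finset R} (h0 : 0 ∉ P) {d q : ℕ} (h : 2 * q ≤ d + 1)
    (hq : q ≤ #P) : q * maxMomentFiber P d q ≤ #P := by
  obtain ⟨u, hu⟩ := exists_eq_ciSup_of_finite (f := fun u : Fin d → R => (momentFiber P q u).ncard)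
  rw [maxMomentFiber, ← hu]
  exact mul_ncard_momentFiber_le h0 h hq u

end MomentUniqueness

section RootsOfUnity

lemma exists_isPrimitiveRoot_of_dvd_card_sub_one {F : Type*} [Field F] [Fintype F] {q : ℕ}
    (hq : q ∣ Fintype.card F - 1) : ∃ ζ : F, IsPrimitiveRoot ζ q := by
  classical
  obtain ⟨g, hg⟩ := IsCyclic.exists_ofOrder_eq_natCard (α := Fˣ)
  rw [Nat.card_eq_fintype_card, Fintype.card_units] at hg
  have horder := orderOf_pow_orderOf_div (orderOf_pos g).ne' (hg ▸ hq)
  exact ⟨_, IsPrimitiveRoot.coe_units_iff.2 (horder ▸ IsPrimitiveRoot.orderOf _)⟩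

lemma cast_ne_zero_of_dvd_card_sub_one {F : Type*} [Field F] [Fintype F] {q : ℕ}
    (hq : q ∣ Fintype.card F - 1) : (q : F) ≠ 0 := by
  obtain ⟨k, hk⟩ := hq
  have hmul : (q : F) * k = -1 := by
    rw [← Nat.cast_mul, ← hk, Nat.cast_sub Fintype.card_pos, FiniteField.cast_card_eq_zero]
    simp
  exact left_ne_zero_of_mul (hmul ▸ neg_ne_zero.2 one_ne_zero)

lemma moment_sum_single_mul_pow {R : Type*} [CommRing R] [IsDomain R] {ζ : R} {q : ℕ}
    (hζ : IsPrimitiveRoot ζ q) (a c : R) (j : ℕ) :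
    moment j (∑ i ∈ range q, Finsupp.single (a * ζ ^ i) c) =
      if q ∣ j then q * (c * a ^ j) else 0 := by
  have hgeom : ∑ i ∈ range q, (ζ ^ j) ^ i = if q ∣ j then (q : R) else 0 := by
    split_ifs with hj
    · simp [(hζ.pow_eq_one_iff_dvd j).2 hj]
    · refine (mul_eq_zero.1 ?_).resolve_left (sub_ne_zero.2 (mt (hζ.pow_eq_one_iff_dvd j).1 hj))
      rw [mul_geom_sum, ← pow_mul, mul_comm, pow_mul, hζ.pow_eq_one, one_pow, sub_self]
  simp only [map_sum, moment_single, mul_pow, ← pow_mul, mul_comm _ j, ← mul_assoc, ← mul_sum]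
  simp only [pow_mul, hgeom, mul_ite, mul_zero]
  split_ifs <;> ring

lemma sum_single_mem_sparseWeights {R ι : Type*} [CommSemiring R] {P : Finset R} {s : Finset ι}
    {x : ι → R} (hx : ∀ i ∈ s, x i ∈ P) (c : ι → R) :
    ∑ i ∈ s, Finsupp.single (x i) (c i) ∈ sparseWeights P #s := by
  classical
  have hsupp : (∑ i ∈ s, Finsupp.single (x i) (c i)).support ⊆ s.image x := fun y hy => by
    obtain ⟨i, hi, hyi⟩ := Finsupp.mem_support_finsetSum y hy
    exact mem_image.2 ⟨i, hi, (mem_singleton.1 (Finsupp.support_single_subset hyi)).symm⟩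
  exact ⟨hsupp.trans (image_subset_iff.2 hx), (card_le_card hsupp).trans card_image_le⟩

variable {F : Type*} [Field F] [Fintype F] [DecidableEq F]

lemma inv_pow_mem_momentFiber {d q : ℕ} (hd : d < 2 * q) (hq : q ∣ Fintype.card F - 1) {a : F}
    (ha : a ≠ 0) : (a ^ q)⁻¹ ∈
      momentFiber (univ.erase 0) q fun j : Fin d => if (j : ℕ) + 1 = q then (1 : F) else 0 := by
  obtain ⟨ζ, hζ⟩ := exists_isPrimitiveRoot_of_dvd_card_sub_one hq
  have hq0 := cast_ne_zero_of_dvd_card_sub_one hq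
  have hζ0 : ζ ≠ 0 := hζ.ne_zero (by omega)
  have hscale : ∀ y, (q : F) * ((q * a ^ q)⁻¹ * y) = (a ^ q)⁻¹ * y := fun y => by field_simp
  have hmoment := moment_sum_single_mul_pow hζ a (q * a ^ q)⁻¹
  have hsparse : ∑ i ∈ range q, Finsupp.single (a * ζ ^ i) (q * a ^ q)⁻¹ ∈
      sparseWeights (univ.erase 0) q := by
    simpa using sum_single_mem_sparseWeights (s := range q) (P := univ.erase 0)
      (x := fun i => a * ζ ^ i) (fun i _ => by simp [ha, hζ0]) fun _ => (q * a ^ q)⁻¹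
  refine mem_momentFiber.2 ⟨_, hsparse, ?_, fun j => ?_⟩
  · rw [hmoment, if_pos (dvd_zero q), hscale, pow_zero, mul_one]
  · have hdvd : q ∣ j + 1 ↔ (j : ℕ) + 1 = q := by
      refine ⟨fun ⟨k, hk⟩ => ?_, fun h => h ▸ dvd_rfl⟩
      have hk_lt : k < 2 := by
        by_contra! h2
        have hqk := Nat.mul_le_mul_left q h2
        omega
      interval_cases k <;> omega
    rw [hmoment, hscale]
    simp only [hdvd]
    split_ifs with hj
    · rw [hj, inv_mul_cancel₀ (pow_ne_zero q ha)]
    · rfl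

theorem div_le_maxMomentFiber {d q : ℕ} (hd : d < 2 * q) (hq : q ∣ Fintype.card F - 1) :
    (Fintype.card F - 1) / q ≤ maxMomentFiber (univ.erase (0 : F)) d q := by
  let inv : Fˣ → F := fun a => (a : F)⁻¹
  have hinv : Function.Injective inv := inv_injective.comp Units.val_injective
  have hcard : ((powMonoidHom q : Fˣ →* Fˣ).range : Set Fˣ).ncard = (Fintype.card F - 1) / q := by
    rw [← Nat.card_coe_set_eq]
    refine (IsCyclic.card_powMonoidHom_range Fˣ q).trans ?_
    rw [Nat.card_eq_fintype_card, Fintype.card_units, Nat.gcd_eq_right hq]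
  have hsub : inv '' (powMonoidHom q : Fˣ →* Fˣ).range ⊆
      momentFiber (univ.erase 0) q fun j : Fin d => if (j : ℕ) + 1 = q then (1 : F) else 0 := by
    rintro _ ⟨_, ⟨a, rfl⟩, rfl⟩
    simpa [inv] using inv_pow_mem_momentFiber hd hq a.ne_zero
  rw [← hcard, ← Set.ncard_image_of_injective _ hinv]
  exact (Set.ncard_le_ncard hsub).trans (ncard_momentFiber_le_maxMomentFiber _ q _)

end RootsOfUnity

section SecondMoment

variable {α β : Type*} [DecidableEq β]

lemma card_sq_le_card_image_mul_card_filter (s : Finset α) (f : α → β) :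
    #s ^ 2 ≤ #(s.image f) * #{p ∈ s ×ˢ s | f p.1 = f p.2} := by
  have hpairs : #{p ∈ s ×ˢ s | f p.1 = f p.2} = ∑ b ∈ s.image f, #{a ∈ s | f a = b} ^ 2 := by
    rw [card_eq_sum_card_fiberwise (f := fun p => f p.1) (t := s.image f)]
    · refine sum_congr rfl fun b _ => ?_
      rw [sq, ← card_product]
      congr 1
      ext p
      simp only [mem_filter, mem_product]
      grind
    · intro p hp
      exact mem_image_of_mem f (mem_product.1 (mem_filter.1 hp).1).1
  rw [hpairs, card_eq_sum_card_image f s]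
  exact sq_sum_le_card_mul_sum_sq

lemma card_sq_le_card_image_mul_card_add (s : Finset α) (f : α → β) :
    #s ^ 2 ≤ #(s.image f) * (#s + #{p ∈ s.offDiag | f p.1 = f p.2}) := by
  classical
  refine (card_sq_le_card_image_mul_card_filter s f).trans (Nat.mul_le_mul_left _ ?_)
  rw [← diag_union_offDiag, filter_union]
  refine (card_union_le _ _).trans (Nat.add_le_add_right ?_ _)
  exact (card_filter_le _ _).trans_eq (diag_card s)

end SecondMoment

section Pigeonhole

variable {R : Type*} [CommSemiring R] [Fintype R] [DecidableEq R]

lemma card_image_momentVec_le {P : Finset R} {d q : ℕ} {E : Finset (R →₀ R)}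
    (hE : ∀ f ∈ E, f ∈ sparseWeights P q) :
    #(E.image (momentVec (d + 1))) ≤ maxMomentFiber P d q * Fintype.card R ^ d := by
  rw [show Fintype.card R ^ d = #(univ : Finset (Fin d → R)) by simp]
  refine card_le_mul_card_image_of_maps_to (f := (Fin.tail : (Fin (d + 1) → R) → Fin d → R))
    (fun _ _ => mem_univ _) _ fun u _ => ?_
  refine le_trans ?_ (ncard_momentFiber_le_maxMomentFiber P q u)
  rw [← Set.ncard_coe_finset]
  refine Set.ncard_le_ncard_of_injOn (fun w => w 0) (fun w hw => ?_) fun w hw w' hw' h0 => ?_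
  · rw [mem_coe, mem_filter] at hw
    obtain ⟨hw, rfl⟩ := hw
    obtain ⟨f, hf, rfl⟩ := mem_image.1 hw
    exact mem_momentFiber.2 ⟨f, hE f hf, rfl, fun _ => rfl⟩
  · rw [mem_coe, mem_filter] at hw hw'
    rw [← Fin.cons_self_tail w, ← Fin.cons_self_tail w', hw.2, hw'.2]
    exact congrArg (fun y => (Fin.cons y u : Fin (d + 1) → R)) h0

end Pigeonhole

section ExactWeights

variable {ι M : Type*} [Zero M] [Fintype M] [DecidableEq M]

lemma mem_finsupp_erase_zero {S : Finset ι} {f : ι →₀ M} :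
    (f ∈ S.finsupp fun _ => univ.erase 0) ↔ f.support = S := by
  classical
  rw [mem_finsupp_iff]
  simp only [mem_erase, mem_univ, and_true, ← Finsupp.mem_support_iff]
  exact subset_antisymm_iff.symm

variable [DecidableEq ι]

/-- The weight functions on `P` with exactly `k` nonzero values. -/
noncomputable def exactWeights (M : Type*) [Zero M] [Fintype M] [DecidableEq M] (P : Finset ι)
    (k : ℕ) : Finset (ι →₀ M) :=
  (P.powersetCard k).biUnion fun S => S.finsupp fun _ => univ.erase 0

lemma mem_exactWeights {P : Finset ι} {k : ℕ} {f : ι →₀ M} :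
    f ∈ exactWeights M P k ↔ f.support ⊆ P ∧ #f.support = k := by
  simp [exactWeights, mem_finsupp_erase_zero, mem_powersetCard]

lemma card_exactWeights (P : Finset ι) (k : ℕ) :
    #(exactWeights M P k) = (#P).choose k * (Fintype.card M - 1) ^ k := by
  rw [exactWeights, card_biUnion, ← card_powersetCard, ← smul_eq_mul, ← sum_const]
  · refine sum_congr rfl fun S hS => ?_
    simp [card_finsupp, (mem_powersetCard.1 hS).2, card_erase_of_mem]
  · intro S _ T _ hST
    refine disjoint_left.2 fun f hfS hfT => hST ?_
    rw [← mem_finsupp_erase_zero.1 hfS, mem_finsupp_erase_zero.1 hfT]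

end ExactWeights

section Collisions

lemma eq_and_eq_of_sub_eq_sub {ι G : Type*} [AddGroup G] {f g f' g' : ι →₀ G}
    (hfg : Disjoint f.support g.support) (hf : f.support = f'.support)
    (hg : g.support = g'.support) (h : f - g = f' - g') : f = f' ∧ g = g' := by
  have hff' : f = f' := by
    ext x
    by_cases hx : x ∈ f.support
    · have hgx := disjoint_left.1 hfg hx
      have hgx' := hg ▸ hgx
      have happ := DFunLike.congr_fun h x
      rwa [Finsupp.sub_apply, Finsupp.sub_apply, Finsupp.notMem_support_iff.1 hgx,
        Finsupp.notMem_support_iff.1 hgx', sub_zero, sub_zero] at happ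
    · have hx' := hf ▸ hx
      rw [Finsupp.notMem_support_iff.1 hx, Finsupp.notMem_support_iff.1 hx']
  subst hff'
  exact ⟨rfl, sub_right_injective h⟩

section Separation

variable {R : Type*} [CommRing R] [IsDomain R] {n : ℕ} {f g f' g' : R →₀ R}

lemma eq_of_momentVec_eq (h : momentVec n f = momentVec n g) (hcard : #(f - g).support ≤ n) :
    f = g := by
  by_contra hfg
  refine (lt_card_support_of_moment_eq_zero (sub_ne_zero.2 hfg) 0 (by simp) fun j hj => ?_).not_ge
    hcard
  rw [zero_add, map_sub, sub_eq_zero]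
  exact congrFun h ⟨j, hj⟩

lemma disjoint_support_of_momentVec_eq (hfg : f ≠ g) (h : momentVec n f = momentVec n g)
    (hcard : #f.support + #g.support ≤ n + 1) : Disjoint f.support g.support := by
  classical
  have hlt := mt (eq_of_momentVec_eq h) hfg
  have hle := card_support_sub_add_le f g
  rw [disjoint_iff_inter_eq_empty, ← card_eq_zero]
  omega

lemma sub_eq_sub_of_momentVec_eq {U : Finset R} (hU : #U ≤ n + 1) (hsub : (f - g).support ⊆ U)
    (hsub' : (f' - g').support ⊆ U) (h : momentVec n f = momentVec n g)
    (h' : momentVec n f' = momentVec n g') {x : R} (hx : x ∈ U)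
    (heq : (f - g) x = (f' - g') x) : f - g = f' - g' := by
  classical
  have hle : (f - g - (f' - g')).support ⊆ U.erase x := by
    refine subset_erase.2 ⟨Finsupp.support_sub.trans (union_subset hsub hsub'), ?_⟩
    rw [Finsupp.notMem_support_iff, Finsupp.sub_apply, heq, sub_self]
  refine eq_of_momentVec_eq (n := n) (by rw [map_sub, map_sub, h, h', sub_self, sub_self]) ?_
  refine (card_le_card hle).trans ?_
  rw [card_erase_of_mem hx]
  omega

end Separation

variable {R : Type*} [CommRing R] [Fintype R] [DecidableEq R]

/-- The pairs of distinct weight functions on `P` with `n + 1` nonzero values whose first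
`2 * n + 1` moments agree. -/
noncomputable def momentCollisions (P : Finset R) (n : ℕ) : Finset ((R →₀ R) × (R →₀ R)) :=
  {p ∈ (exactWeights R P (n + 1)).offDiag |
    momentVec (2 * n + 1) p.1 = momentVec (2 * n + 1) p.2}

lemma mem_momentCollisions {P : Finset R} {n : ℕ} {p : (R →₀ R) × (R →₀ R)} :
    p ∈ momentCollisions P n ↔
      (p.1 ∈ exactWeights R P (n + 1) ∧ p.2 ∈ exactWeights R P (n + 1) ∧ p.1 ≠ p.2) ∧
        momentVec (2 * n + 1) p.1 = momentVec (2 * n + 1) p.2 := by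
  rw [momentCollisions, mem_filter, mem_offDiag]

variable [IsDomain R]

lemma disjoint_support_of_mem_momentCollisions {P : Finset R} {n : ℕ} {p : (R →₀ R) × (R →₀ R)}
    (hp : p ∈ momentCollisions P n) : Disjoint p.1.support p.2.support := by
  obtain ⟨⟨hf, hg, hfg⟩, h⟩ := mem_momentCollisions.1 hp
  refine disjoint_support_of_momentVec_eq hfg h ?_
  rw [(mem_exactWeights.1 hf).2, (mem_exactWeights.1 hg).2]
  omega

lemma card_momentCollisions_of_support_le (P : Finset R) {n : ℕ} {S T : Finset R}
    (hS : #S = n + 1) (hT : #T = n + 1) :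
    #{p ∈ momentCollisions P n | (p.1.support, p.2.support) = (S, T)} ≤ Fintype.card R - 1 := by
  obtain ⟨x, hx⟩ : S.Nonempty := card_pos.1 (by omega)
  have hU : #(S ∪ T) ≤ 2 * n + 1 + 1 := (card_union_le S T).trans (by omega)
  rw [← card_univ, ← card_erase_of_mem (mem_univ (0 : R))]
  refine card_le_card_of_injOn (fun p => p.1 x) (fun p hp => ?_) fun p hp p' hp' hpp' => ?_
  · obtain ⟨-, hsupp⟩ := mem_filter.1 hp
    obtain ⟨rfl, rfl⟩ := Prod.mk.inj hsupp
    simpa using hx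
  · rw [mem_coe, mem_filter] at hp hp'
    obtain ⟨hp, hsupp⟩ := hp
    obtain ⟨hp', hsupp'⟩ := hp'
    obtain ⟨rfl, rfl⟩ := Prod.mk.inj hsupp
    obtain ⟨hf, hg⟩ := Prod.mk.inj hsupp'
    have hdisj := disjoint_support_of_mem_momentCollisions hp
    have hgx := Finsupp.notMem_support_iff.1 (disjoint_left.1 hdisj hx)
    have hgx' := Finsupp.notMem_support_iff.1 (hg ▸ disjoint_left.1 hdisj hx)
    have hsub := sub_eq_sub_of_momentVec_eq hU Finsupp.support_sub
      (hf ▸ hg ▸ Finsupp.support_sub) (mem_momentCollisions.1 hp).2 (mem_momentCollisions.1 hp').2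
      (mem_union_left _ hx) (by simpa [hgx, hgx'] using hpp')
    exact Prod.ext_iff.2 (eq_and_eq_of_sub_eq_sub hdisj hf.symm hg.symm hsub)

theorem card_momentCollisions_le (P : Finset R) (n : ℕ) :
    #(momentCollisions P n) ≤ (Fintype.card R - 1) * (#P).choose (n + 1) ^ 2 := by
  rw [← card_powersetCard, sq, ← card_product]
  refine card_le_mul_card_image_of_maps_to (f := fun p => (p.1.support, p.2.support))
    (fun p hp => ?_) _ fun ST hST => ?_
  · obtain ⟨⟨hf, hg, -⟩, -⟩ := mem_momentCollisions.1 hp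
    exact mk_mem_product (mem_powersetCard.2 (mem_exactWeights.1 hf))
      (mem_powersetCard.2 (mem_exactWeights.1 hg))
  · obtain ⟨hS, hT⟩ := mem_product.1 hST
    exact card_momentCollisions_of_support_le P (mem_powersetCard.1 hS).2 (mem_powersetCard.1 hT).2

theorem choose_mul_pow_le_card_image (P : Finset R) (n : ℕ) :
    (#P).choose (n + 1) * (Fintype.card R - 1) ^ (2 * n + 1) ≤
      #((exactWeights R P (n + 1)).image (momentVec (2 * n + 1))) *
        ((Fintype.card R - 1) ^ n + (#P).choose (n + 1)) := by
  have hm : 0 < Fintype.card R - 1 := Nat.sub_pos_of_lt Fintype.one_lt_card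
  obtain hC | hC := ((#P).choose (n + 1)).eq_zero_or_pos
  · simp [hC]
  have hmoment := (card_sq_le_card_image_mul_card_add (exactWeights R P (n + 1))
    (momentVec (2 * n + 1))).trans
      (Nat.mul_le_mul_left _ (Nat.add_le_add_left (card_momentCollisions_le P n) _))
  rw [card_exactWeights] at hmoment
  refine Nat.le_of_mul_le_mul_left ?_ (Nat.mul_pos hC hm)
  set C := (#P).choose (n + 1)
  set m := Fintype.card R - 1
  set N := #((exactWeights R P (n + 1)).image (momentVec (2 * n + 1)))
  calc C * m * (C * m ^ (2 * n + 1)) = (C * m ^ (n + 1)) ^ 2 := by ring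
    _ ≤ N * (C * m ^ (n + 1) + m * C ^ 2) := hmoment
    _ = C * m * (N * (m ^ n + C)) := by ring

end Collisions

theorem choose_mul_pow_le_maxMomentFiber {R : Type*} [CommRing R] [IsDomain R] [Fintype R]
    (P : Finset R) (n : ℕ) :
    (#P).choose (n + 1) * (Fintype.card R - 1) ^ (2 * n + 1) ≤
      maxMomentFiber P (2 * n) (n + 1) * Fintype.card R ^ (2 * n) *
        ((Fintype.card R - 1) ^ n + (#P).choose (n + 1)) := by
  classical
  exact (choose_mul_pow_le_card_image P n).trans <| Nat.mul_le_mul_right _ <|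
    card_image_momentVec_le fun _ hf => (mem_exactWeights.1 hf).imp_right Eq.le

section ExtendWeight

variable {F : Type*} [Field F]

/-- Divides a weight function by `x - c` and corrects its value at `c` so that the first moment
vanishes. The moments of `f` are, up to a linear recursion, those of `extendWeight c f` shifted by
one, so one more moment is controlled at the price of one more support point. -/
noncomputable def extendWeight (c : F) : (F →₀ F) →ₗ[F] (F →₀ F) :=
  Finsupp.linearCombination F fun x =>
    Finsupp.single x (x - c)⁻¹ - Finsupp.single c (x / (c * (x - c)))

lemma extendWeight_apply (c : F) (f : F →₀ F) :
    extendWeight c f =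
      f.sum fun x a => a • (Finsupp.single x (x - c)⁻¹ - Finsupp.single c (x / (c * (x - c)))) :=
  Finsupp.linearCombination_apply F f

lemma moment_extendWeight (c : F) (f : F →₀ F) (j : ℕ) :
    moment j (extendWeight c f) =
      f.sum fun x a => a * ((x - c)⁻¹ * x ^ j - x / (c * (x - c)) * c ^ j) := by
  simp [extendWeight_apply, map_finsuppSum, moment_single]

lemma moment_one_extendWeight {c : F} (hc : c ≠ 0) (f : F →₀ F) :
    moment 1 (extendWeight c f) = 0 := by
  rw [moment_extendWeight]
  refine sum_eq_zero fun x _ => ?_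
  field_simp
  ring

lemma moment_succ_extendWeight {c : F} {f : F →₀ F} (hcf : c ∉ f.support) (j : ℕ) :
    moment (j + 1) (extendWeight c f) = c * moment j (extendWeight c f) + moment j f := by
  rw [moment_extendWeight, moment_extendWeight, moment_apply, Finsupp.mul_sum, ← Finsupp.sum_add]
  refine sum_congr rfl fun x hx => ?_
  have hxc : x - c ≠ 0 := sub_ne_zero.2 (ne_of_mem_of_not_mem hx hcf)
  field_simp
  ring

lemma moment_zero_extendWeight {c : F} (hc : c ≠ 0) {f : F →₀ F} (hcf : c ∉ f.support) :
    moment 0 (extendWeight c f) = -(c⁻¹ * moment 0 f) := by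
  have hrec := moment_succ_extendWeight hcf 0
  rw [zero_add, moment_one_extendWeight hc, eq_comm, add_eq_zero_iff_eq_neg] at hrec
  rw [← mul_neg, ← hrec, inv_mul_cancel_left₀ hc]

lemma moment_extendWeight_eq {c : F} (hc : c ≠ 0) {d : ℕ} {f g : F →₀ F} (hcf : c ∉ f.support)
    (hcg : c ∉ g.support) (h : ∀ j : Fin d, moment (j + 1) f = moment (j + 1) g) :
    ∀ j : Fin (d + 1), moment (j + 1) (extendWeight c f) = moment (j + 1) (extendWeight c g) :=
  Fin.induction (by simp [moment_one_extendWeight hc]) fun j ih => by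
    simp only [Fin.val_succ, Fin.val_castSucc] at ih ⊢
    rw [moment_succ_extendWeight hcf, moment_succ_extendWeight hcg, ih, h j]

lemma extendWeight_mem_sparseWeights {P : Finset F} {q : ℕ} {c : F} (hc : c ∈ P) {f : F →₀ F}
    (hf : f ∈ sparseWeights P q) : extendWeight c f ∈ sparseWeights P (q + 1) := by
  classical
  have hsupp : (extendWeight c f).support ⊆ insert c f.support := by
    rw [extendWeight_apply]
    intro y hy
    obtain ⟨x, hx, hyx⟩ := Finsupp.mem_support_finsetSum y hy
    obtain hyx | hyc := mem_union.1 (Finsupp.support_sub (Finsupp.support_smul hyx))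
    · rw [mem_singleton.1 (Finsupp.support_single_subset hyx)]
      exact mem_insert_of_mem hx
    · rw [mem_singleton.1 (Finsupp.support_single_subset hyc)]
      exact mem_insert_self c _
  exact ⟨hsupp.trans (insert_subset hc hf.1),
    (card_le_card hsupp).trans ((card_insert_le _ _).trans (Nat.succ_le_succ hf.2))⟩

theorem maxMomentFiber_erase_le [Finite F] [DecidableEq F] {P : Finset F} {c : F} (hcP : c ∈ P)
    (hc : c ≠ 0) (d q : ℕ) :
    maxMomentFiber (P.erase c) d q ≤ maxMomentFiber P (d + 1) (q + 1) := by
  refine ciSup_le fun u => ?_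
  obtain hempty | ⟨y₀, hy₀⟩ := (momentFiber (P.erase c) q u).eq_empty_or_nonempty
  · simp [hempty]
  obtain ⟨f₀, hf₀, -, hu₀⟩ := mem_momentFiber.1 hy₀
  have hinj : Function.Injective fun y : F => -(c⁻¹ * y) :=
    neg_injective.comp (mul_right_injective₀ (inv_ne_zero hc))
  have hsparse : ∀ f ∈ sparseWeights (P.erase c) q, f ∈ sparseWeights P q ∧ c ∉ f.support :=
    fun f hf => ⟨hf.imp_left fun h => h.trans (erase_subset c P),
      fun hcf => notMem_erase c P (hf.1 hcf)⟩
  have hsub : (fun y => -(c⁻¹ * y)) '' momentFiber (P.erase c) q u ⊆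
      momentFiber P (q + 1) fun j : Fin (d + 1) => moment (j + 1) (extendWeight c f₀) := by
    rintro _ ⟨y, hy, rfl⟩
    obtain ⟨f, hf, rfl, hu⟩ := mem_momentFiber.1 hy
    obtain ⟨hfP, hcf⟩ := hsparse f hf
    exact mem_momentFiber.2 ⟨extendWeight c f, extendWeight_mem_sparseWeights hcP hfP,
      moment_zero_extendWeight hc hcf, moment_extendWeight_eq hc hcf (hsparse f₀ hf₀).2
        fun j => (hu j).trans (hu₀ j).symm⟩
  rw [← Set.ncard_image_of_injective _ hinj]
  exact (Set.ncard_le_ncard hsub).trans (ncard_momentFiber_le_maxMomentFiber P (q + 1) _)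

end ExtendWeight

section Estimates

/-! In these estimates `N` is the number of available points and `N + ε = |F| - 1`: all nonzero
points are available for even `d`, and one of them is set aside for odd `d`. -/

lemma succ_choose_two (k : ℕ) : (k + 1).choose 2 = k + k.choose 2 := by
  rw [Nat.choose_succ_succ', Nat.choose_one_right]

lemma pow_succ_le_descFactorial_add (N ε n : ℕ) :
    (N + ε) ^ (n + 1) ≤
      N.descFactorial (n + 1) + (N + ε) ^ n * ((n + 1).choose 2 + ε * (n + 1)) := by
  induction n with
  | zero => simp
  | succ n ih =>
    have hD : N.descFactorial (n + 1) ≤ (N + ε) ^ (n + 1) :=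
      (Nat.descFactorial_le_pow N (n + 1)).trans (Nat.pow_le_pow_left (N.le_add_right ε) _)
    have hN : N + ε ≤ N - (n + 1) + (n + 1 + ε) := by omega
    set D := N.descFactorial (n + 1)
    set s := (n + 1).choose 2 + ε * (n + 1)
    calc (N + ε) ^ (n + 1 + 1) = (N + ε) * (N + ε) ^ (n + 1) := pow_succ' _ _
      _ ≤ (N + ε) * (D + (N + ε) ^ n * s) := Nat.mul_le_mul_left _ ih
      _ = (N + ε) * D + (N + ε) ^ (n + 1) * s := by ring
      _ ≤ (N - (n + 1) + (n + 1 + ε)) * D + (N + ε) ^ (n + 1) * s := by gcongr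
      _ = (N - (n + 1)) * D + ((n + 1 + ε) * D + (N + ε) ^ (n + 1) * s) := by ring
      _ ≤ (N - (n + 1)) * D + ((n + 1 + ε) * (N + ε) ^ (n + 1) + (N + ε) ^ (n + 1) * s) := by
          gcongr
      _ = N.descFactorial (n + 1 + 1) +
            (N + ε) ^ (n + 1) * ((n + 1 + 1).choose 2 + ε * (n + 1 + 1)) := by
          rw [Nat.descFactorial_succ, succ_choose_two (n + 1)]
          ring

lemma succ_pow_succ_le (m j : ℕ) : (m + 1) ^ (j + 1) ≤ m ^ j * (m + 1) + j * (m + 1) ^ j := by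
  induction j with
  | zero => simp
  | succ j ih =>
    calc (m + 1) ^ (j + 1 + 1) = (m + 1) * (m + 1) ^ (j + 1) := pow_succ' _ _
      _ ≤ (m + 1) * (m ^ j * (m + 1) + j * (m + 1) ^ j) := Nat.mul_le_mul_left _ ih
      _ = m ^ (j + 1) * (m + 1) + j * (m + 1) ^ (j + 1) + m ^ j * (m + 1) := by ring
      _ ≤ m ^ (j + 1) * (m + 1) + j * (m + 1) ^ (j + 1) + (m + 1) ^ j * (m + 1) := by
          gcongr
          exact m.le_succ
      _ = m ^ (j + 1) * (m + 1) + (j + 1) * (m + 1) ^ (j + 1) := by ring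

lemma choose_two_succ_le_factorial {k : ℕ} (hk : 3 ≤ k) : (k + 1).choose 2 ≤ k ! := by
  induction k, hk using Nat.le_induction with
  | base => decide
  | succ k hk ih =>
    calc (k + 1 + 1).choose 2 = k + 1 + (k + 1).choose 2 := succ_choose_two _
      _ ≤ (k + 1) * k ! := by nlinarith [Nat.self_le_factorial k]
      _ = (k + 1)! := (Nat.factorial_succ k).symm

lemma choose_two_lt_factorial {k : ℕ} (hk : 0 < k) : k.choose 2 < k ! := by
  induction k, hk using Nat.le_induction with
  | base => decide
  | succ k _ ih =>
    calc (k + 1).choose 2 = k + k.choose 2 := succ_choose_two _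
      _ < (k + 1) * k ! := by nlinarith [Nat.self_le_factorial k]
      _ = (k + 1)! := (Nat.factorial_succ k).symm

lemma factorial_add_mul_le {m ε n : ℕ} (hε : ε ≤ 1) (hm : (n + 1)! + ε + 2 * n + 1 ≤ m) :
    (n + 1)! + ((n + 1)! + ε) * ((n + 1).choose 2 + ε * (n + 1)) ≤
      ε * m + ((n + 1)! + ε) * (n + 1)! := by
  interval_cases ε
  · nlinarith [choose_two_lt_factorial n.succ_pos]
  · have hchoose : (n + 1).choose 2 + 1 * (n + 1) = (n + 1 + 1).choose 2 := by
      rw [succ_choose_two (n + 1), one_mul, add_comm]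
    rw [hchoose]
    obtain hn | hn := Nat.lt_or_ge n 2
    · interval_cases n <;> simp [Nat.factorial, Nat.choose] at hm ⊢ <;> omega
    · nlinarith [choose_two_succ_le_factorial (by omega : 3 ≤ n + 1)]

lemma pow_mul_succ_le {N ε n : ℕ} (hε : ε ≤ 1) (hN : (n + 1)! + ε + 2 * n + 1 ≤ N + ε) :
    (N + ε) ^ n * (N + ε + 1) ≤ ((n + 1)! + ε) * ((N + ε) ^ n + N.choose (n + 1)) := by
  have hdesc := pow_succ_le_descFactorial_add N ε n
  have hfact := factorial_add_mul_le hε hN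
  rw [Nat.descFactorial_eq_factorial_mul_choose, pow_succ] at hdesc
  refine Nat.le_of_mul_le_mul_left ?_ (n + 1).factorial_pos
  linarith [Nat.mul_le_mul_left ((n + 1)! + ε) hdesc, Nat.mul_le_mul_left ((N + ε) ^ n) hfact]

lemma le_add_of_mul_pow_le {m t M j : ℕ} (h : (m + 1 - t) * m ^ j ≤ M * (m + 1) ^ j) :
    m + 1 ≤ M + t + j := by
  by_contra! hlt
  obtain ⟨r, hr⟩ := Nat.exists_eq_add_of_le (show t + j ≤ m + 1 by omega)
  have hsub : m + 1 - t = r + j := by omega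
  have hbernoulli := succ_pow_succ_le m j
  rw [hsub] at h
  have hpow : 0 < (m + 1) ^ j := by positivity
  have hmul : (r + j) * (m + 1) ≤ M * (m + 1) + (r + j) * j := by
    refine Nat.le_of_mul_le_mul_left ?_ hpow
    calc (m + 1) ^ j * ((r + j) * (m + 1)) = (r + j) * (m + 1) ^ (j + 1) := by ring
      _ ≤ (r + j) * (m ^ j * (m + 1) + j * (m + 1) ^ j) := Nat.mul_le_mul_left _ hbernoulli
      _ = (r + j) * m ^ j * (m + 1) + (r + j) * j * (m + 1) ^ j := by ring
      _ ≤ M * (m + 1) ^ j * (m + 1) + (r + j) * j * (m + 1) ^ j := by gcongr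
      _ = (m + 1) ^ j * (M * (m + 1) + (r + j) * j) := by ring
  nlinarith

theorem le_add_of_choose_mul_pow_le {N ε n M : ℕ} (hε : ε ≤ 1)
    (h : N.choose (n + 1) * (N + ε) ^ (2 * n + 1) ≤
      M * (N + ε + 1) ^ (2 * n) * ((N + ε) ^ n + N.choose (n + 1))) :
    N + ε + 1 ≤ M + ((n + 1)! + ε) + (2 * n + 1) := by
  by_contra! hlt
  have hsecond := pow_mul_succ_le hε (n := n) (N := N) (by omega)
  generalize (n + 1)! + ε = t at *
  generalize N + ε = m at *
  generalize N.choose (n + 1) = C at *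
  have hpos : 0 < m ^ n + C := by
    have : 0 < m := by omega
    positivity
  have hC : (m + 1 - t) * (m ^ n + C) ≤ C * (m + 1) := by
    rw [Nat.sub_mul, tsub_le_iff_right]
    linarith
  refine hlt.not_ge (le_add_of_mul_pow_le ?_)
  refine Nat.le_of_mul_le_mul_left ?_ hpos
  calc (m ^ n + C) * ((m + 1 - t) * m ^ (2 * n + 1))
      = (m + 1 - t) * (m ^ n + C) * m ^ (2 * n + 1) := by ring
    _ ≤ C * (m + 1) * m ^ (2 * n + 1) := Nat.mul_le_mul_right _ hC
    _ = C * m ^ (2 * n + 1) * (m + 1) := by ring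
    _ ≤ M * (m + 1) ^ (2 * n) * (m ^ n + C) * (m + 1) := Nat.mul_le_mul_right _ h
    _ = (m ^ n + C) * (M * (m + 1) ^ (2 * n + 1)) := by ring

end Estimates

section ManyQueries

variable {R : Type*} [CommSemiring R] [Finite R]

lemma maxMomentFiber_mono {P : Finset R} {d q q' : ℕ} (h : q ≤ q') :
    maxMomentFiber P d q ≤ maxMomentFiber P d q' :=
  ciSup_mono (Set.finite_range _).bddAbove fun _ => Set.ncard_le_ncard fun _ =>
    fun ⟨f, hf, hfy⟩ => ⟨f, hf.imp_right fun hfq => hfq.trans h, hfy⟩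

variable {F : Type*} [Field F] [Fintype F] [DecidableEq F]

theorem card_le_maxMomentFiber_add {d q : ℕ} (h : d + 2 ≤ 2 * q) :
    Fintype.card F ≤ maxMomentFiber (univ.erase (0 : F)) d q + ((d / 2 + 1)! + d + 1) := by
  have hP : #(univ.erase (0 : F)) = Fintype.card F - 1 := card_erase_of_mem (mem_univ _)
  obtain ⟨N, hN⟩ : ∃ N, Fintype.card F = N + 1 + 1 :=
    ⟨Fintype.card F - 2, by have := Fintype.one_lt_card (α := F); omega⟩
  obtain ⟨n, rfl | rfl⟩ := d.even_or_odd'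
  · have hmono : maxMomentFiber (univ.erase (0 : F)) (2 * n) (n + 1) ≤ _ :=
      maxMomentFiber_mono (show n + 1 ≤ q by omega)
    have hcount := choose_mul_pow_le_maxMomentFiber (univ.erase (0 : F)) n
    rw [hP, hN, Nat.add_sub_cancel] at hcount
    have hbound := le_add_of_choose_mul_pow_le (ε := 0) zero_le_one hcount
    rw [hN, show 2 * n / 2 = n by omega]
    omega
  · have hmono := (maxMomentFiber_erase_le (by simp) one_ne_zero (2 * n) (n + 1)).trans
      (maxMomentFiber_mono (P := univ.erase (0 : F)) (show n + 1 + 1 ≤ q by omega))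
    have hcount := choose_mul_pow_le_maxMomentFiber ((univ.erase (0 : F)).erase 1) n
    rw [card_erase_of_mem (by simp), hP, hN, Nat.add_sub_cancel, Nat.add_sub_cancel] at hcount
    have hbound := le_add_of_choose_mul_pow_le le_rfl hcount
    rw [hN, show (2 * n + 1) / 2 = n by omega]
    omega

end ManyQueries

theorem theorem5p5 {F : Type*} [Field F] [Fintype F] [DecidableEq F] (d q : ℕ) :
    ∃ P : ℝ, IsMaxExtrapolationProb F d q P ∧
      (2 * q ≤ d → P = 1 / (Fintype.card F : ℝ)) ∧
      (2 * q = d + 1 → q ≤ Fintype.card F - 1 →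
        P ≤ (((Fintype.card F - 1) / q : ℕ) : ℝ) / (Fintype.card F : ℝ)) ∧
      (2 * q = d + 1 → q ∣ Fintype.card F - 1 →
        P = (((Fintype.card F - 1) / q : ℕ) : ℝ) / (Fintype.card F : ℝ)) ∧
      (d + 2 ≤ 2 * q →
        1 - (((d / 2 + 1)! + d + 1 : ℕ) : ℝ) / (Fintype.card F : ℝ) ≤ P) := by
  have hcard : #(univ.erase (0 : F)) = Fintype.card F - 1 := card_erase_of_mem (mem_univ 0)
  have h0 : (0 : F) ∉ univ.erase 0 := notMem_erase 0 univ
  have hF : (0 : ℝ) < Fintype.card F := Nat.cast_pos.2 Fintype.card_pos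
  have hpos : 0 < Fintype.card F - 1 := Nat.sub_pos_of_lt Fintype.one_lt_card
  have hupper (h : 2 * q = d + 1) (hq : q ≤ Fintype.card F - 1) :
      maxMomentFiber (univ.erase (0 : F)) d q ≤ (Fintype.card F - 1) / q := by
    rw [Nat.le_div_iff_mul_le (by omega), mul_comm, ← hcard]
    exact mul_maxMomentFiber_le h0 h.le (hcard ▸ hq)
  refine ⟨_, isMaxExtrapolationProb_maxMomentFiber d q, fun h => ?_, fun h hq => ?_,
    fun h hq => ?_, fun h => ?_⟩
  · rw [maxMomentFiber_eq_one h0 h, Nat.cast_one]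
  · gcongr
    exact hupper h hq
  · rw [(hupper h (Nat.le_of_dvd hpos hq)).antisymm (div_le_maxMomentFiber (by omega) hq)]
  · rw [sub_le_iff_le_add, ← add_div, le_div_iff₀ hF, one_mul]
    exact_mod_cast card_le_maxMomentFiber_add h
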